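/- Let $\mathbb B=\{0,1\}$ be the Boolean semifield ($1+1=1$), let $\mathbb Z_{\min}^+=(\mathbb N\cup\{\infty\},\min,+)$, whose element $n\in\mathbb N$ is written multiplicatively $q^n$ (so $\infty$ is the zero element and $q^0$ the unit), and let $\mathbb R_+^{\max}=([0,\infty),\max,\cdot)$. Semirings are commutative. A semiring $R$ is multiplicatively cancellative if $ab=ac$ and $a\neq0$ imply $b=c$. A reduced correspondence is a triple $(R,\ell,r)$ where $R$ is a multiplicatively cancellative semiring and $\ell,r:\mathbb Z_{\min}^+\to R$ are semiring morphisms with $\ell^{-1}(\{0\})=\{0\}=r^{-1}(\{0\})$, such that $R$ is generated by $\ell(\mathbb Z_{\min}^+)\,r(\mathbb Z_{\min}^+)$. Two reduced correspondences are considered equal if there is a semiring isomorphism between them that intertwines the left morphisms and the right morphisms. The composition $(R,\ell,r)\circ(R',\ell',r')$ is obtained from the semiring $S=R\otimes_{\mathbb Z_{\min}^+}R'$, where $\mathbb Z_{\min}^+$ acts on $R$ through $r$ and on $R'$ through $\ell'$: one passes to the multiplicatively cancellative reduction $S/\!\sim$, where $a\sim b$ if and only if $ca=cb$ for some $c\neq0$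 in $S$, and takes the sub-semiring of $S/\!\sim$ generated by the images of $\ell\otimes\mathrm{Id}$ and $\mathrm{Id}\otimes r'$, with these two morphisms as left and right morphisms. Fix $q\in(0,1)$. For $\lambda>0$ let $\mathcal F(\lambda):\mathbb Z_{\min}^+\otimes_{\mathbb B}\mathbb Z_{\min}^+\to\mathbb R_+^{\max}$ be the semiring morphism $\sum q^{n_i}\otimes q^{m_i}\mapsto q^{\inf_i(\lambda n_i+m_i)}$, and let $\mathcal R(\lambda)$ be its range. The Frobenius correspondence is the reduced correspondence $\Psi(\lambda)=(\mathcal R(\lambda),\ell(\lambda),r(\lambda))$ with $\ell(\lambda)(x)=\mathcal F(\lambda)(x\otimes1)$ and $r(\lambda)(x)=\mathcal F(\lambda)(1\otimes x)$. Let $\mathcal R_\epsilon$ be the sub-semiring, generated by the germs of $\epsilon\mapsto q$ and $\epsilon\mapsto q^{1+\epsilon}$, of the semiring of germs at $\epsilon=0$ of continuous functions from a neighborhood of $0\in\mathbb R$ to $\mathbb R_+^{\max}$, with pointwise operations. The tangential deformation of the identity correspondence is $\mathrm{Id}_\epsilon=(\mathcal R_\epsilon,\ell_\epsilon,r_\epsilon)$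 with $\ell_\epsilon(q^n)=q^{(1+\epsilon)n}$ and $r_\epsilon(q^n)=q^n$ for all $n\in\mathbb N$. Theorem. Let $\lambda,\lambda'>0$ be real numbers. (i) If $\lambda\lambda'\notin\mathbb Q$, then $\Psi(\lambda)\circ\Psi(\lambda')=\Psi(\lambda\lambda')$. (ii) If $\lambda\in\mathbb Q$ and $\lambda'\in\mathbb Q$, then $\Psi(\lambda)\circ\Psi(\lambda')=\Psi(\lambda\lambda')$. (iii) If $\lambda$ and $\lambda'$ are irrational and $\lambda\lambda'\in\mathbb Q$, then $\Psi(\lambda)\circ\Psi(\lambda')=\mathrm{Id}_\epsilon\circ\Psi(\lambda\lambda')$. -/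

import Mathlib

open scoped NNReal TensorProduct Topology

namespace ArithmeticSite

universe u

/-! ### Semirings of characteristic one -/

/-- The semiring `ℤ_min^+ = (ℕ ∪ {∞}, min, +)`. The element written multiplicatively `q^n` is
`Tropical.trop n`; the zero element is `Tropical.trop ⊤`, the unit is `Tropical.trop 0 = q^0`. -/
abbrev ZMinPlus : Type := Tropical ℕ∞

/-- The Boolean semifield `𝔹 = {0, 1}` with `1 + 1 = 1`. -/
def BoolSemifield : Type := Bool

namespace BoolSemifield

instance : DecidableEq BoolSemifield := inferInstanceAs (DecidableEq Bool)

instance : Fintype BoolSemifield := inferInstanceAs (Fintype Bool)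

instance : CommSemiring BoolSemifield where
  add a b := Bool.or a b
  zero := false
  mul a b := Bool.and a b
  one := true
  add_assoc := by decide
  zero_add := by decide
  add_zero := by decide
  add_comm := by decide
  mul_assoc := by decide
  mul_comm := by decide
  one_mul := by decide
  mul_one := by decide
  zero_mul := by decide
  mul_zero := by decide
  left_distrib := by decide
  right_distrib := by decide
  nsmul n a := if n = 0 then false else a
  nsmul_zero _ := rfl
  nsmul_succ n a := by
    have h : ∀ a : Bool, Bool.or a a = a := by decide
    rcases n with _ | n
    · exact (Bool.false_or a).symm
    · exact (h a).symm

/-- The structure morphism `𝔹 → R` of a semiring `R` of characteristic one. -/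
def toSemiring (R : Type u) [CommSemiring R] (h : (1 : R) + 1 = 1) : BoolSemifield →+* R where
  toFun a := if a = 0 then 0 else 1
  map_one' := if_neg (by decide)
  map_zero' := if_pos rfl
  map_add' := by
    have key : ∀ a b : BoolSemifield, (a = 0 ∧ b = 0 ∧ a + b = 0) ∨ (a = 0 ∧ b ≠ 0 ∧ a + b ≠ 0) ∨
      (a ≠ 0 ∧ b = 0 ∧ a + b ≠ 0) ∨ (a ≠ 0 ∧ b ≠ 0 ∧ a + b ≠ 0) := by decide
    intro a b
    rcases key a b with ⟨h1, h2, h3⟩ | ⟨h1, h2, h3⟩ | ⟨h1, h2, h3⟩ | ⟨h1, h2, h3⟩ <;>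
      simp only [if_pos, if_neg, h1, h2, h3, not_false_eq_true, zero_add, add_zero, h]
  map_mul' := by
    have key : ∀ a b : BoolSemifield, a * b = 0 ↔ a = 0 ∨ b = 0 := by decide
    intro a b
    by_cases ha : a = 0 <;> by_cases hb : b = 0 <;> simp [key, ha, hb]

/-- The support character `R → 𝔹`, sending `0` to `0` and everything else to `1`. -/
noncomputable def support (R : Type u) [CommSemiring R] [NoZeroDivisors R] [Nontrivial R]
    (h : (1 : R) + 1 = 1) : R →+* BoolSemifield := by
  classical
  have hid : ∀ a : R, a + a = a := fun a => by
    have := congrArg (a * ·) h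
    simpa [mul_add] using this
  have hz : ∀ a b : R, a + b = 0 → a = 0 := fun a b hab => by
    calc a = a + (a + b) := by rw [hab, add_zero]
      _ = a + b := by rw [← add_assoc, hid]
      _ = 0 := hab
  exact
    { toFun := fun a => if a = 0 then 0 else 1
      map_one' := if_neg one_ne_zero
      map_zero' := if_pos rfl
      map_mul' := fun a b => by
        by_cases ha : a = 0 <;> by_cases hb : b = 0 <;> simp [ha, hb]
      map_add' := fun a b => by
        have h11 : (1 : BoolSemifield) + 1 = 1 := by decide
        by_cases ha : a = 0
        · by_cases hb : b = 0 <;> simp [ha, hb]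
        · have hab : a + b ≠ 0 := fun hab => ha (hz a b hab)
          by_cases hb : b = 0
          · simp [ha, hb]
          · simp [ha, hb, hab, h11] }

theorem support_eq_zero {R : Type u} [CommSemiring R] [NoZeroDivisors R] [Nontrivial R]
    (h : (1 : R) + 1 = 1) (a : R) : support R h a = 0 ↔ a = 0 := by
  classical
  change (if a = 0 then (0 : BoolSemifield) else 1) = 0 ↔ a = 0
  have h10 : (1 : BoolSemifield) ≠ 0 := by decide
  by_cases ha : a = 0 <;> simp [ha, h10]

end BoolSemifield

theorem ZMinPlus.one_add_one : (1 : ZMinPlus) + 1 = 1 := Tropical.add_self 1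

noncomputable instance : Algebra BoolSemifield ZMinPlus :=
  (BoolSemifield.toSemiring ZMinPlus ZMinPlus.one_add_one).toAlgebra

/-- The semifield `ℝ_+^max`: the set `[0, ∞)` with addition `max` and the ordinary product. -/
@[ext]
structure RMax : Type where
  val : ℝ≥0

namespace RMax

noncomputable instance : Zero RMax := ⟨⟨0⟩⟩
noncomputable instance : One RMax := ⟨⟨1⟩⟩
noncomputable instance : Add RMax := ⟨fun a b => ⟨max a.val b.val⟩⟩
noncomputable instance : Mul RMax := ⟨fun a b => ⟨a.val * b.val⟩⟩

@[simp] theorem val_zero : (0 : RMax).val = 0 := rfl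
@[simp] theorem val_one : (1 : RMax).val = 1 := rfl
@[simp] theorem val_add (a b : RMax) : (a + b).val = max a.val b.val := rfl
@[simp] theorem val_mul (a b : RMax) : (a * b).val = a.val * b.val := rfl

noncomputable instance : CommSemiring RMax where
  add_assoc a b c := by ext; simp [max_assoc]
  zero_add a := by ext; simp
  add_zero a := by ext; simp
  add_comm a b := by ext; simp [max_comm]
  mul_assoc a b c := by ext; simp [mul_assoc]
  mul_comm a b := by ext; simp [mul_comm]
  one_mul a := by ext; simp
  mul_one a := by ext; simp
  zero_mul a := by ext; simp
  mul_zero a := by ext; simp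
  left_distrib a b c := by ext; simp [mul_max]
  right_distrib a b c := by ext; simp [max_mul]
  nsmul := nsmulRec

theorem one_add_one : (1 : RMax) + 1 = 1 := by ext; simp

theorem mul_left_cancel_of_ne {a b c : RMax} (ha : a ≠ 0) (h : a * b = a * c) : b = c := by
  have ha' : a.val ≠ 0 := fun h0 => ha (RMax.ext h0)
  have h' : a.val * b.val = a.val * c.val := congrArg RMax.val h
  exact RMax.ext (mul_left_cancel₀ ha' h')

noncomputable instance : Algebra BoolSemifield RMax :=
  (BoolSemifield.toSemiring RMax one_add_one).toAlgebra

/-- The usual topology of `[0, ∞)`. -/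
instance : TopologicalSpace RMax := TopologicalSpace.induced RMax.val inferInstance

theorem continuous_val : Continuous RMax.val := continuous_induced_dom

instance : ContinuousAdd RMax :=
  ⟨continuous_induced_rng.2
    ((continuous_val.comp continuous_fst).max (continuous_val.comp continuous_snd))⟩

instance : ContinuousMul RMax :=
  ⟨continuous_induced_rng.2
    ((continuous_val.comp continuous_fst).mul (continuous_val.comp continuous_snd))⟩

/-- The element `q^s` of `ℝ_+^max`, for a real exponent `s`. -/
noncomputable def qpow (q : ℝ≥0) (s : ℝ) : RMax := ⟨q ^ s⟩

theorem qpow_ne_zero {q : ℝ≥0} (hq : 0 < q) (s : ℝ) : qpow q s ≠ 0 := fun h =>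
  (NNReal.rpow_pos hq).ne' (congrArg RMax.val h)

theorem qpow_add_one {q : ℝ≥0} (hq1 : q < 1) {s : ℝ} (hs : 0 ≤ s) : qpow q s + 1 = 1 := by
  ext
  simp [qpow, NNReal.rpow_le_one hq1.le hs]

end RMax

/-- The semiring morphism `ℤ_min^+ → R`, `q^n ↦ x^n`, `∞ ↦ 0`, for `x` with `x + 1 = 1` in a
semiring `R` of characteristic one. -/
noncomputable def powHom {R : Type u} [CommSemiring R] (h : (1 : R) + 1 = 1) (x : R)
    (hx : x + 1 = 1) : ZMinPlus →+* R where
  toFun a := if Tropical.untrop a = ⊤ then 0 else x ^ (Tropical.untrop a).toNat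
  map_one' := by simp
  map_zero' := by simp
  map_mul' a b := by
    rw [Tropical.untrop_mul]
    by_cases ha : Tropical.untrop a = ⊤
    · simp [ha]
    by_cases hb : Tropical.untrop b = ⊤
    · simp [hb]
    · simp [ha, hb, ENat.toNat_add ha hb, pow_add]
  map_add' a b := by
    have hk : ∀ k : ℕ, x ^ k + 1 = 1 := by
      intro k
      induction k with
      | zero => simpa using h
      | succ k ih =>
        calc x ^ (k + 1) + 1 = x ^ k * x + (x ^ k + 1) := by rw [ih, pow_succ]
          _ = x ^ k * (x + 1) + 1 := by ring
          _ = 1 := by rw [hx, mul_one, ih]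
    have hmn : ∀ m n : ℕ, m ≤ n → x ^ m + x ^ n = x ^ m := by
      intro m n hle
      obtain ⟨k, rfl⟩ := Nat.exists_eq_add_of_le hle
      calc x ^ m + x ^ (m + k) = x ^ m * (x ^ k + 1) := by ring
        _ = x ^ m := by rw [hk, mul_one]
    rw [Tropical.untrop_add]
    by_cases ha : Tropical.untrop a = ⊤
    · simp [ha]
    by_cases hb : Tropical.untrop b = ⊤
    · simp [hb]
    obtain ⟨m, hm⟩ := ENat.ne_top_iff_exists.1 ha
    obtain ⟨n, hn⟩ := ENat.ne_top_iff_exists.1 hb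
    rw [← hm, ← hn]
    rcases le_total m n with hle | hle
    · rw [min_eq_left (by exact_mod_cast hle)]
      simp [hmn m n hle]
    · rw [min_eq_right (by exact_mod_cast hle)]
      simp [add_comm (x ^ m), hmn n m hle]

theorem powHom_eq_zero {R : Type u} [CommSemiring R] (h : (1 : R) + 1 = 1) (x : R)
    (hx : x + 1 = 1) (hx0 : ∀ n : ℕ, x ^ n ≠ 0) (a : ZMinPlus) (ha : powHom h x hx a = 0) :
    a = 0 := by
  change (if Tropical.untrop a = ⊤ then 0 else x ^ (Tropical.untrop a).toNat) = 0 at ha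
  by_contra hne
  have : Tropical.untrop a ≠ ⊤ := fun h' => hne (Tropical.untrop_injective h')
  rw [if_neg this] at ha
  exact hx0 _ ha

theorem powHom_trop_one {R : Type u} [CommSemiring R] (h : (1 : R) + 1 = 1) (x : R)
    (hx : x + 1 = 1) : powHom h x hx (Tropical.trop 1) = x := by
  change (if (1 : ℕ∞) = ⊤ then 0 else x ^ (1 : ℕ∞).toNat) = x
  simp

theorem powHom_mem {R : Type u} [CommSemiring R] (h : (1 : R) + 1 = 1) (x : R)
    (hx : x + 1 = 1) (T : Subsemiring R) (hT : x ∈ T) (a : ZMinPlus) : powHom h x hx a ∈ T := by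
  change (if Tropical.untrop a = ⊤ then 0 else x ^ (Tropical.untrop a).toNat) ∈ T
  split_ifs
  · exact T.zero_mem
  · exact T.pow_mem hT _

/-! ### Reduced correspondences -/

/-- A reduced correspondence `(R, ℓ, r)` on the arithmetic site: `R` is a multiplicatively
cancellative semiring, `ℓ, r : ℤ_min^+ → R` are semiring morphisms with `ℓ⁻¹(0) = {0}`,
`r⁻¹(0) = {0}`, and `R` is generated by the products `ℓ(x) r(y)`. -/
structure ReducedCorrespondence : Type (u + 1) where
  carrier : Type u
  [commSemiring : CommSemiring carrier]
  [isCancelMulZero : IsCancelMulZero carrier]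
  left : ZMinPlus →+* carrier
  right : ZMinPlus →+* carrier
  left_preimage_zero : left ⁻¹' {0} = {0}
  right_preimage_zero : right ⁻¹' {0} = {0}
  generated : Subsemiring.closure {z : carrier | ∃ x y, z = left x * right y} = ⊤

attribute [instance] ReducedCorrespondence.commSemiring ReducedCorrespondence.isCancelMulZero

/-- Equality of reduced correspondences: an isomorphism of semirings which intertwines the left
morphisms and the right morphisms. -/
def ReducedCorrespondence.Equal (C D : ReducedCorrespondence.{u}) : Prop :=
  ∃ e : C.carrier ≃+* D.carrier,
    (∀ x, e (C.left x) = D.left x) ∧ (∀ x, e (C.right x) = D.right x)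

/-! ### The multiplicatively cancellative reduction -/

section CancelReduction

variable (S : Type u) [CommSemiring S] [NoZeroDivisors S] [Nontrivial S]

/-- The congruence `a ∼ b ↔ ∃ c ≠ 0, c a = c b`. Its quotient is the image of `S` in its semiring
of quotients. -/
def cancelCon : RingCon S where
  r a b := ∃ c : S, c ≠ 0 ∧ c * a = c * b
  iseqv :=
    { refl := fun _ => ⟨1, one_ne_zero, rfl⟩
      symm := fun ⟨c, hc, h⟩ => ⟨c, hc, h.symm⟩
      trans := fun {x y z} ⟨c, hc, h⟩ ⟨d, hd, h'⟩ => ⟨c * d, mul_ne_zero hc hd, by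
        calc c * d * x = d * (c * x) := by ring
          _ = c * (d * y) := by rw [h]; ring
          _ = c * d * z := by rw [h']; ring⟩ }
  add' := fun {w x y z} ⟨c, hc, h⟩ ⟨d, hd, h'⟩ => ⟨c * d, mul_ne_zero hc hd, by
    calc c * d * (w + y) = d * (c * w) + c * (d * y) := by ring
      _ = c * d * (x + z) := by rw [h, h']; ring⟩
  mul' := fun {w x y z} ⟨c, hc, h⟩ ⟨d, hd, h'⟩ => ⟨c * d, mul_ne_zero hc hd, by
    calc c * d * (w * y) = (c * w) * (d * y) := by ring
      _ = c * d * (x * z) := by rw [h, h']; ring⟩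

/-- The multiplicatively cancellative semiring associated to `S`. -/
abbrev CancelReduction : Type u := (cancelCon S).Quotient

variable {S}

theorem cancelCon_mk_eq {a b : S} :
    (cancelCon S).mk' a = (cancelCon S).mk' b ↔ ∃ c : S, c ≠ 0 ∧ c * a = c * b :=
  (cancelCon S).eq

theorem cancelCon_mk_eq_zero {a : S} : (cancelCon S).mk' a = 0 ↔ a = 0 := by
  constructor
  · intro h
    rw [← map_zero (cancelCon S).mk', cancelCon_mk_eq] at h
    obtain ⟨c, hc, h⟩ := h
    rw [mul_zero] at h
    exact (mul_eq_zero.1 h).resolve_left hc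
  · rintro rfl
    exact map_zero _

instance : IsCancelMulZero (CancelReduction S) := by
  have key : ∀ a b c : CancelReduction S, a ≠ 0 → a * b = a * c → b = c := by
    intro a b c ha h
    obtain ⟨a, rfl⟩ := (cancelCon S).mk'_surjective a
    obtain ⟨b, rfl⟩ := (cancelCon S).mk'_surjective b
    obtain ⟨c, rfl⟩ := (cancelCon S).mk'_surjective c
    rw [← map_mul, ← map_mul, cancelCon_mk_eq] at h
    obtain ⟨d, hd, h⟩ := h
    refine cancelCon_mk_eq.2 ⟨d * a, mul_ne_zero hd fun h0 => ha (by rw [h0, map_zero]), ?_⟩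
    rw [mul_assoc, h, mul_assoc]
  exact
    { mul_left_cancel_of_ne_zero := fun {a} ha b c h => key a b c ha h
      mul_right_cancel_of_ne_zero := fun {a} ha b c h =>
        key a b c ha (by simpa only [mul_comm a] using h) }

end CancelReduction

/-! ### Composition of reduced correspondences -/

namespace ReducedCorrespondence

variable (C D : ReducedCorrespondence.{u})

instance : Nontrivial C.carrier := by
  refine ⟨⟨1, 0, fun h => ?_⟩⟩
  have : (1 : ZMinPlus) ∈ C.left ⁻¹' {0} := by simpa using h
  rw [C.left_preimage_zero] at this
  have h0 : (0 : ℕ∞) = ⊤ := congrArg Tropical.untrop (Set.mem_singleton_iff.1 this)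
  exact ENat.zero_ne_top h0

theorem one_add_one : (1 : C.carrier) + 1 = 1 := by
  rw [← map_one C.left, ← map_add, ZMinPlus.one_add_one]

/-- `R` regarded as an algebra over `ℤ_min^+` by means of `r`. -/
def ViaRight : Type u := C.carrier

/-- `R` regarded as an algebra over `ℤ_min^+` by means of `ℓ`. -/
def ViaLeft : Type u := C.carrier

instance : CommSemiring C.ViaRight := inferInstanceAs (CommSemiring C.carrier)
instance : CommSemiring C.ViaLeft := inferInstanceAs (CommSemiring C.carrier)
instance : IsCancelMulZero C.ViaRight := inferInstanceAs (IsCancelMulZero C.carrier)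
instance : IsCancelMulZero C.ViaLeft := inferInstanceAs (IsCancelMulZero C.carrier)
instance : Nontrivial C.ViaRight := inferInstanceAs (Nontrivial C.carrier)
instance : Nontrivial C.ViaLeft := inferInstanceAs (Nontrivial C.carrier)
instance : Algebra ZMinPlus C.ViaRight := RingHom.toAlgebra C.right
instance : Algebra ZMinPlus C.ViaLeft := RingHom.toAlgebra C.left

/-- The identity map `R → R`, with values in the algebra given by `r`. -/
def toViaRight : C.carrier ≃+* C.ViaRight := RingEquiv.refl _

/-- The identity map `R → R`, with values in the algebra given by `ℓ`. -/
def toViaLeft : C.carrier ≃+* C.ViaLeft := RingEquiv.refl _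

/-- The semiring `R ⊗_{ℤ_min^+} R'`, where `ℤ_min^+` acts on `R` by `r` and on `R'` by `ℓ'`. -/
abbrev Tensor : Type u := C.ViaRight ⊗[ZMinPlus] D.ViaLeft

/-- The tensor product is an integral semiring: the supports of the two factors define a character
to `𝔹` with trivial kernel. -/
theorem exists_character : ∃ f : Tensor C D →+* BoolSemifield, (∀ t, f t = 0 → t = 0) ∧
    ∀ (a : C.ViaRight) (b : D.ViaLeft), f (a ⊗ₜ[ZMinPlus] b) = 0 → a = 0 ∨ b = 0 := by
  let s : ZMinPlus →+* BoolSemifield := (BoolSemifield.support C.carrier C.one_add_one).comp C.right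
  let _ : Algebra ZMinPlus BoolSemifield := s.toAlgebra
  have hs : ∀ x, s x = 0 ↔ x = 0 := fun x => by
    have : C.right x = 0 ↔ x = 0 := by
      have := Set.ext_iff.1 C.right_preimage_zero x
      simpa using this
    rw [← this]
    exact BoolSemifield.support_eq_zero C.one_add_one _
  have hb : ∀ a b : BoolSemifield, (a = 0 ↔ b = 0) → a = b := by decide
  let f : C.ViaRight →ₐ[ZMinPlus] BoolSemifield :=
    { BoolSemifield.support C.ViaRight C.one_add_one with commutes' := fun _ => rfl }
  let g : D.ViaLeft →ₐ[ZMinPlus] BoolSemifield :=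
    { BoolSemifield.support D.ViaLeft D.one_add_one with
      commutes' := fun x => hb _ _ <| by
        have h1 : D.left x = 0 ↔ x = 0 := by
          have := Set.ext_iff.1 D.left_preimage_zero x
          simpa using this
        refine Iff.trans ?_ (hs x).symm
        rw [← h1]
        exact BoolSemifield.support_eq_zero D.one_add_one _ }
  have hadd : ∀ a b : BoolSemifield, a + b = 0 → a = 0 ∧ b = 0 := by decide
  have hmul : ∀ a b : BoolSemifield, a * b = 0 → a = 0 ∨ b = 0 := by decide
  have htmul : ∀ (a : C.ViaRight) (b : D.ViaLeft),
      (Algebra.TensorProduct.productMap f g).toRingHom (a ⊗ₜ[ZMinPlus] b) = 0 →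
        a = 0 ∨ b = 0 := by
    intro a b h
    have h' : f a * g b = 0 := by simpa using h
    exact (hmul _ _ h').imp (BoolSemifield.support_eq_zero C.one_add_one a).1
      (BoolSemifield.support_eq_zero D.one_add_one b).1
  refine ⟨(Algebra.TensorProduct.productMap f g).toRingHom, fun t => ?_, htmul⟩
  induction t using TensorProduct.induction_on with
  | zero => exact fun _ => rfl
  | tmul a b =>
    intro h
    rcases htmul a b h with h0 | h0
    · rw [h0, TensorProduct.zero_tmul]
    · rw [h0, TensorProduct.tmul_zero]
  | add x y hx hy =>
    intro h
    rw [map_add] at h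
    rw [hx (hadd _ _ h).1, hy (hadd _ _ h).2, add_zero]

instance : NoZeroDivisors (Tensor C D) := by
  obtain ⟨f, hf, -⟩ := exists_character C D
  have hmul : ∀ a b : BoolSemifield, a * b = 0 → a = 0 ∨ b = 0 := by decide
  refine ⟨fun {a b} h => ?_⟩
  have := congrArg f h
  rw [map_mul, map_zero] at this
  exact (hmul _ _ this).imp (hf a) (hf b)

instance : Nontrivial (Tensor C D) := by
  obtain ⟨f, -, -⟩ := exists_character C D
  have h10 : (1 : BoolSemifield) ≠ 0 := by decide
  exact ⟨⟨1, 0, fun h => h10 (by rw [← map_one f, h, map_zero])⟩⟩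

/-- The morphism `ℓ ⊗ Id` from `ℤ_min^+` to the cancellative reduction of `R ⊗ R'`. -/
noncomputable def tensorLeft : ZMinPlus →+* CancelReduction (Tensor C D) :=
  (cancelCon (Tensor C D)).mk'.comp
    ((Algebra.TensorProduct.includeLeftRingHom).comp (C.toViaRight.toRingHom.comp C.left))

/-- The morphism `Id ⊗ r'` from `ℤ_min^+` to the cancellative reduction of `R ⊗ R'`. -/
noncomputable def tensorRight : ZMinPlus →+* CancelReduction (Tensor C D) :=
  (cancelCon (Tensor C D)).mk'.comp
    ((Algebra.TensorProduct.includeRight.toRingHom).comp (D.toViaLeft.toRingHom.comp D.right))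

theorem tmul_eq_zero {a : C.ViaRight} {b : D.ViaLeft}
    (h : (a ⊗ₜ[ZMinPlus] b : Tensor C D) = 0) : a = 0 ∨ b = 0 := by
  obtain ⟨f, -, hf⟩ := exists_character C D
  exact hf a b (by rw [h, map_zero])

theorem tensorLeft_eq_zero (x : ZMinPlus) (h : tensorLeft C D x = 0) : x = 0 := by
  have h1 := tmul_eq_zero C D (cancelCon_mk_eq_zero.1 h)
  have h2 : C.left x = 0 := h1.resolve_right one_ne_zero
  have h3 : x ∈ C.left ⁻¹' {0} := h2
  rwa [C.left_preimage_zero] at h3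

theorem tensorRight_eq_zero (x : ZMinPlus) (h : tensorRight C D x = 0) : x = 0 := by
  have h1 := tmul_eq_zero C D (cancelCon_mk_eq_zero.1 h)
  have h2 : D.right x = 0 := h1.resolve_left one_ne_zero
  have h3 : x ∈ D.right ⁻¹' {0} := h2
  rwa [D.right_preimage_zero] at h3

/-- The reduced correspondence carried by a sub-semiring `T` of a semiring `R`, when `T` is
multiplicatively cancellative and is generated by the products `ℓ(x) r(y)`. -/
def ofSubsemiring {R : Type u} [CommSemiring R] (T : Subsemiring R) (l r : ZMinPlus →+* R)
    (hcancel : ∀ a ∈ T, ∀ b ∈ T, ∀ c ∈ T, a ≠ 0 → a * b = a * c → b = c)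
    (hl : ∀ x, l x ∈ T) (hr : ∀ x, r x ∈ T)
    (hl0 : ∀ x, l x = 0 → x = 0) (hr0 : ∀ x, r x = 0 → x = 0)
    (hgen : T ≤ Subsemiring.closure {z | ∃ x y, z = l x * r y}) :
    ReducedCorrespondence.{u} where
  carrier := T
  isCancelMulZero :=
    have key : ∀ a b c : T, a ≠ 0 → a * b = a * c → b = c := fun a b c ha h =>
      Subtype.ext (hcancel a a.2 b b.2 c c.2 (fun h0 => ha (Subtype.ext h0))
        (congrArg Subtype.val h))
    { mul_left_cancel_of_ne_zero := fun {a} ha b c h => key a b c ha h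
      mul_right_cancel_of_ne_zero := fun {a} ha b c h =>
        key a b c ha (by simpa only [mul_comm a] using h) }
  left := l.codRestrict T hl
  right := r.codRestrict T hr
  left_preimage_zero := by
    ext x
    refine ⟨fun h => hl0 x (congrArg Subtype.val (Set.mem_singleton_iff.1 h)), fun h => ?_⟩
    rw [Set.mem_singleton_iff.1 h]
    exact map_zero _
  right_preimage_zero := by
    ext x
    refine ⟨fun h => hr0 x (congrArg Subtype.val (Set.mem_singleton_iff.1 h)), fun h => ?_⟩
    rw [Set.mem_singleton_iff.1 h]
    exact map_zero _
  generated := by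
    rw [eq_top_iff]
    intro z _
    have hz : (z : R) ∈ (Subsemiring.closure {z : T | ∃ x y,
        z = l.codRestrict T hl x * r.codRestrict T hr y}).map T.subtype := by
      rw [RingHom.map_closureS]
      refine Subsemiring.closure_mono ?_ (hgen z.2)
      rintro _ ⟨x, y, rfl⟩
      exact ⟨_, ⟨x, y, rfl⟩, rfl⟩
    obtain ⟨w, hw, h⟩ := hz
    rwa [Subtype.ext h] at hw

/-- The composition `(R, ℓ, r) ∘ (R', ℓ', r')`: the sub-semiring, generated by the images of
`ℓ ⊗ Id` and `Id ⊗ r'`, of the multiplicatively cancellative reduction of `R ⊗_{ℤ_min^+} R'`. -/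
noncomputable def comp : ReducedCorrespondence.{u} :=
  ofSubsemiring
    (Subsemiring.closure (Set.range (tensorLeft C D) ∪ Set.range (tensorRight C D)))
    (tensorLeft C D) (tensorRight C D)
    (fun _ _ _ _ _ _ ha h => mul_left_cancel₀ ha h)
    (fun x => Subsemiring.subset_closure (Or.inl ⟨x, rfl⟩))
    (fun x => Subsemiring.subset_closure (Or.inr ⟨x, rfl⟩))
    (tensorLeft_eq_zero C D) (tensorRight_eq_zero C D)
    (Subsemiring.closure_mono (by
      rintro _ (⟨x, rfl⟩ | ⟨x, rfl⟩)
      · exact ⟨x, 1, by rw [map_one, mul_one]⟩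
      · exact ⟨1, x, by rw [map_one, one_mul]⟩))

end ReducedCorrespondence

/-! ### The Frobenius correspondences -/

section Frobenius

variable (q : ℝ≥0) (hq0 : 0 < q) (hq1 : q < 1) (lam : ℝ) (hlam : 0 < lam)

/-- The semiring morphism `ℤ_min^+ → ℝ_+^max`, `q^n ↦ q^(s n)`, for `s ≥ 0`. -/
noncomputable def scaleHom (s : ℝ) (hs : 0 ≤ s) : ZMinPlus →+* RMax :=
  powHom RMax.one_add_one (RMax.qpow q s) (RMax.qpow_add_one hq1 hs)

theorem scaleHom_eq_zero (hq0 : 0 < q) (s : ℝ) (hs : 0 ≤ s) (x : ZMinPlus)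
    (hx : scaleHom q hq1 s hs x = 0) : x = 0 := by
  refine powHom_eq_zero _ _ _ (fun n => ?_) x hx
  induction n with
  | zero => exact fun h => one_ne_zero (congrArg RMax.val h)
  | succ n ih =>
    intro h
    rw [pow_succ, ← mul_zero (RMax.qpow q s ^ n)] at h
    exact RMax.qpow_ne_zero hq0 s (RMax.mul_left_cancel_of_ne ih h)

/-- A morphism between semirings of characteristic one is `𝔹`-linear. -/
noncomputable def scaleAlgHom (s : ℝ) (hs : 0 ≤ s) : ZMinPlus →ₐ[BoolSemifield] RMax :=
  { scaleHom q hq1 s hs with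
    commutes' := fun a => by
      have h : ∀ a : BoolSemifield, a = 0 ∨ a = 1 := by decide
      rcases h a with rfl | rfl
      · simp
      · simp }

@[simp] theorem scaleAlgHom_apply (s : ℝ) (hs : 0 ≤ s) (x : ZMinPlus) :
    scaleAlgHom q hq1 s hs x = scaleHom q hq1 s hs x := rfl

/-- The morphism `𝓕(λ, q) : ℤ_min^+ ⊗_𝔹 ℤ_min^+ → ℝ_+^max`,
`∑ q^(n_i) ⊗ q^(m_i) ↦ q^α`, `α = inf (λ n_i + m_i)`. -/
noncomputable def frobF : ZMinPlus ⊗[BoolSemifield] ZMinPlus →+* RMax :=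
  (Algebra.TensorProduct.productMap (scaleAlgHom q hq1 lam hlam.le)
    (scaleAlgHom q hq1 1 zero_le_one)).toRingHom

/-- The Frobenius correspondence `Ψ(λ) = (𝓡(λ), 𝓕(λ) ∘ ι₁, 𝓕(λ) ∘ ι₂)`, where `𝓡(λ)` is the range
of `𝓕(λ, q)`, `ι₁(x) = x ⊗ 1` and `ι₂(x) = 1 ⊗ x`. -/
noncomputable def frobenius : ReducedCorrespondence.{0} :=
  ReducedCorrespondence.ofSubsemiring (frobF q hq1 lam hlam).rangeS
    ((frobF q hq1 lam hlam).comp Algebra.TensorProduct.includeLeftRingHom)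
    ((frobF q hq1 lam hlam).comp Algebra.TensorProduct.includeRight.toRingHom)
    (fun _ _ _ _ _ _ ha h => RMax.mul_left_cancel_of_ne ha h)
    (fun x => ⟨x ⊗ₜ 1, rfl⟩) (fun x => ⟨1 ⊗ₜ x, rfl⟩)
    (fun x hx => scaleHom_eq_zero q hq1 hq0 lam hlam.le x (by simpa [frobF] using hx))
    (fun x hx => scaleHom_eq_zero q hq1 hq0 1 zero_le_one x (by simpa [frobF] using hx))
    (by
      rintro _ ⟨t, rfl⟩
      induction t using TensorProduct.induction_on with
      | zero => rw [map_zero]; exact Subsemiring.zero_mem _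
      | tmul a b =>
        refine Subsemiring.subset_closure ⟨a, b, ?_⟩
        rw [RingHom.comp_apply, RingHom.comp_apply, ← map_mul]
        simp
      | add x y hx hy => rw [map_add]; exact Subsemiring.add_mem _ hx hy)

end Frobenius

/-! ### The tangential deformation of the identity -/

/-- The semiring `Germ_{ε = 0}(ℝ_+^max)` of germs at `0 ∈ ℝ` of functions with values in `ℝ_+^max`
which are continuous in a neighborhood of `0`, with the pointwise operations. -/
def contGerm : Subsemiring (Filter.Germ (𝓝 (0 : ℝ)) RMax) where
  carrier := {g | ∃ f : ℝ → RMax, (∀ᶠ e in 𝓝 (0 : ℝ), ContinuousAt f e) ∧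
    g = (f : Filter.Germ (𝓝 (0 : ℝ)) RMax)}
  zero_mem' := ⟨0, Filter.Eventually.of_forall fun _ => continuousAt_const, rfl⟩
  one_mem' := ⟨1, Filter.Eventually.of_forall fun _ => continuousAt_const, rfl⟩
  add_mem' := by
    rintro _ _ ⟨f, hf, rfl⟩ ⟨g, hg, rfl⟩
    exact ⟨f + g, (hf.and hg).mono fun _ h => h.1.add h.2, rfl⟩
  mul_mem' := by
    rintro _ _ ⟨f, hf, rfl⟩ ⟨g, hg, rfl⟩
    exact ⟨f * g, (hf.and hg).mono fun _ h => h.1.mul h.2, rfl⟩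

section Deformation

variable (q : ℝ≥0) (hq0 : 0 < q) (hq1 : q < 1)

theorem continuous_qpow (hq0 : 0 < q) {s : ℝ → ℝ} (hs : Continuous s) :
    Continuous fun e => RMax.qpow q (s e) :=
  continuous_induced_rng.2 (continuous_iff_continuousAt.2 fun _ =>
    continuousAt_const.nnrpow hs.continuousAt (Or.inl hq0.ne'))

/-- The germ at `ε = 0` of the function `ε ↦ q^(s(ε))`, for a continuous exponent `s`. -/
noncomputable def qgerm (s : ℝ → ℝ) (hs : Continuous s) : contGerm :=
  ⟨((fun e => RMax.qpow q (s e) : ℝ → RMax) : Filter.Germ (𝓝 (0 : ℝ)) RMax),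
    _, Filter.Eventually.of_forall fun _ => (continuous_qpow q hq0 hs).continuousAt, rfl⟩

/-- The germ of the constant function `q`. -/
noncomputable def qConst : contGerm := qgerm q hq0 (fun _ => 1) continuous_const

/-- The germ `θ_{1+ε}(q) = q^(1+ε)`. -/
noncomputable def qDeform : contGerm :=
  qgerm q hq0 (fun e => 1 + e) (continuous_const.add continuous_id)

/-- The sub-semiring `𝓡_ε` of `Germ_{ε = 0}(ℝ_+^max)` generated by `q` and `q^(1+ε)`. -/
noncomputable def deformedSemiring : Subsemiring contGerm :=
  Subsemiring.closure {qConst q hq0, qDeform q hq0}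

theorem contGerm_one_add_one : (1 : contGerm) + 1 = 1 :=
  Subtype.ext (congrArg (fun f : ℝ → RMax => (f : Filter.Germ (𝓝 (0 : ℝ)) RMax))
    (funext fun _ => RMax.one_add_one))

theorem qgerm_add_one (hq1 : q < 1) (s : ℝ → ℝ) (hs : Continuous s)
    (hs0 : ∀ᶠ e in 𝓝 (0 : ℝ), 0 ≤ s e) : qgerm q hq0 s hs + 1 = 1 :=
  Subtype.ext (Filter.Germ.coe_eq.2 (hs0.mono fun _ he => RMax.qpow_add_one hq1 he))

theorem qConst_add_one (hq1 : q < 1) : qConst q hq0 + 1 = 1 :=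
  qgerm_add_one q hq0 hq1 _ _ (Filter.Eventually.of_forall fun _ => zero_le_one)

theorem qDeform_add_one (hq1 : q < 1) : qDeform q hq0 + 1 = 1 :=
  qgerm_add_one q hq0 hq1 _ _ (by
    filter_upwards [Ioi_mem_nhds (show (-1 : ℝ) < 0 by norm_num)] with e he
    have : (-1 : ℝ) < e := he
    linarith)

/-- The germ `x` has no zero in a neighborhood of `0`. -/
def NonvanishingGerm (x : contGerm) : Prop :=
  ∃ f : ℝ → RMax, (∀ᶠ e in 𝓝 (0 : ℝ), f e ≠ 0) ∧
    (x : Filter.Germ (𝓝 (0 : ℝ)) RMax) = (f : Filter.Germ (𝓝 (0 : ℝ)) RMax)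

theorem NonvanishingGerm.mul {x y : contGerm} (hx : NonvanishingGerm x)
    (hy : NonvanishingGerm y) : NonvanishingGerm (x * y) := by
  obtain ⟨f, hf, hxf⟩ := hx
  obtain ⟨g, hg, hyg⟩ := hy
  refine ⟨f * g, ?_, ?_⟩
  · filter_upwards [hf, hg] with e h1 h2 h
    exact h2 (RMax.mul_left_cancel_of_ne h1 (h.trans (mul_zero _).symm))
  · change (x : Filter.Germ (𝓝 (0 : ℝ)) RMax) * (y : Filter.Germ (𝓝 (0 : ℝ)) RMax) = _
    rw [hxf, hyg]
    rfl

theorem NonvanishingGerm.add {x y : contGerm} (hx : NonvanishingGerm x)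
    (hy : NonvanishingGerm y) : NonvanishingGerm (x + y) := by
  obtain ⟨f, hf, hxf⟩ := hx
  obtain ⟨g, hg, hyg⟩ := hy
  refine ⟨f + g, ?_, ?_⟩
  · filter_upwards [hf] with e h1 h
    have h2 : max (f e).val (g e).val = 0 := congrArg RMax.val h
    exact h1 (RMax.ext (le_antisymm ((le_max_left _ _).trans h2.le) zero_le))
  · change (x : Filter.Germ (𝓝 (0 : ℝ)) RMax) + (y : Filter.Germ (𝓝 (0 : ℝ)) RMax) = _
    rw [hxf, hyg]
    rfl

theorem NonvanishingGerm.one : NonvanishingGerm 1 :=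
  ⟨1, Filter.Eventually.of_forall fun _ h => one_ne_zero (congrArg RMax.val h), rfl⟩

theorem NonvanishingGerm.pow {x : contGerm} (hx : NonvanishingGerm x) (n : ℕ) :
    NonvanishingGerm (x ^ n) := by
  induction n with
  | zero => rw [pow_zero]; exact .one
  | succ n ih => rw [pow_succ]; exact ih.mul hx

theorem NonvanishingGerm.ne_zero {x : contGerm} (hx : NonvanishingGerm x) : x ≠ 0 := by
  rintro rfl
  obtain ⟨f, hf, h⟩ := hx
  obtain ⟨e, h1, h2⟩ := (hf.and (Filter.Germ.coe_eq.1 h)).exists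
  exact h1 h2.symm

theorem NonvanishingGerm.mul_left_cancel {x y z : contGerm} (hx : NonvanishingGerm x)
    (h : x * y = x * z) : y = z := by
  obtain ⟨f, hf, hxf⟩ := hx
  obtain ⟨g, -, hg⟩ := y.2
  obtain ⟨k, -, hk⟩ := z.2
  have h' : (x : Filter.Germ (𝓝 (0 : ℝ)) RMax) * (y : Filter.Germ (𝓝 (0 : ℝ)) RMax)
      = (x : Filter.Germ (𝓝 (0 : ℝ)) RMax) * (z : Filter.Germ (𝓝 (0 : ℝ)) RMax) :=
    congrArg Subtype.val h
  rw [hxf, hg, hk] at h'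
  refine Subtype.ext ?_
  rw [hg, hk]
  refine Filter.Germ.coe_eq.2 ?_
  filter_upwards [hf, Filter.Germ.coe_eq.1 h'] with e h1 h2
  exact RMax.mul_left_cancel_of_ne h1 h2

theorem qgerm_nonvanishing (s : ℝ → ℝ) (hs : Continuous s) :
    NonvanishingGerm (qgerm q hq0 s hs) :=
  ⟨_, Filter.Eventually.of_forall fun e => RMax.qpow_ne_zero hq0 (s e), rfl⟩

theorem deformedSemiring_nonvanishing (x : contGerm) (hx : x ∈ deformedSemiring q hq0) :
    x = 0 ∨ NonvanishingGerm x := by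
  induction hx using Subsemiring.closure_induction with
  | mem x hx =>
    rcases hx with rfl | rfl
    · exact Or.inr (qgerm_nonvanishing q hq0 _ _)
    · exact Or.inr (qgerm_nonvanishing q hq0 _ _)
  | zero => exact Or.inl rfl
  | one => exact Or.inr .one
  | add x y _ _ hx hy =>
    rcases hx with rfl | hx
    · simpa using hy
    rcases hy with rfl | hy
    · simpa using Or.inr hx
    · exact Or.inr (hx.add hy)
  | mul x y _ _ hx hy =>
    rcases hx with rfl | hx
    · exact Or.inl (zero_mul y)
    rcases hy with rfl | hy
    · exact Or.inl (mul_zero x)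
    · exact Or.inr (hx.mul hy)

/-- The tangential deformation `Id_ε = (𝓡_ε, ℓ_ε, r_ε)` of the identity correspondence:
`ℓ_ε(q^n) = θ_{1+ε}(q^n) = q^((1+ε) n)` and `r_ε(q^n) = q^n`. -/
noncomputable def idDeform : ReducedCorrespondence.{0} :=
  ReducedCorrespondence.ofSubsemiring (deformedSemiring q hq0)
    (powHom contGerm_one_add_one (qDeform q hq0) (qDeform_add_one q hq0 hq1))
    (powHom contGerm_one_add_one (qConst q hq0) (qConst_add_one q hq0 hq1))
    (fun a ha _ _ _ _ ha0 h =>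
      ((deformedSemiring_nonvanishing q hq0 a ha).resolve_left ha0).mul_left_cancel h)
    (powHom_mem _ _ _ _ (Subsemiring.subset_closure (by simp)))
    (powHom_mem _ _ _ _ (Subsemiring.subset_closure (by simp)))
    (powHom_eq_zero _ _ _ fun n => ((qgerm_nonvanishing q hq0 _ _).pow n).ne_zero)
    (powHom_eq_zero _ _ _ fun n => ((qgerm_nonvanishing q hq0 _ _).pow n).ne_zero)
    (Subsemiring.closure_mono (by
      rintro _ (rfl | rfl)
      · exact ⟨1, Tropical.trop 1, by
          rw [map_one, one_mul]; exact (powHom_trop_one _ _ _).symm⟩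
      · exact ⟨Tropical.trop 1, 1, by
          rw [map_one, mul_one]; exact (powHom_trop_one _ _ _).symm⟩))

end Deformation

end ArithmeticSite

/-! A cancellative semiring with `1 + 1 = 1` is ordered by `a ≤ b ↔ a + b = b`, and there powers
reflect the order. Every element of a reduced correspondence is a finite sum of monomials `ℓ(q)^n
r(q)^m`, so the correspondence is known once it is known which monomials lie below which sums. Two
correspondences are shown equal by embedding both in one semiring with the same images of the
generators (`equal_of_injective`).

In `Ψ(λ) ∘ Ψ(λ')` let `X`, `Y` be the left and right generators and `T` the middle one, shared by
the two factors. The monomial `X^n Y^m` has value `λλ'n + m`, and larger values mean smaller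
elements. A strict inequality of values always gives a comparison of monomials: a rational exponent
of `T` strictly in between splits it into one comparison in each factor (`monomial_le_of_lt`). Only
ties remain. If `λλ'` is irrational, distinct monomials never tie. If `λ = a/b`, then `X^b = T^a`
carries `b`-th powers into the second factor, where ties are equalities. In both cases the value map
to `RMax` is injective.

If `λ` is irrational, the monomials of the first factor are pairwise distinct, and it can be
deformed: `X ↦ q^(λλ'(1+ε))`, `T ↦ q^λ'`, `Y ↦ q` defines a morphism to germs at `ε = 0`. Tied
monomials are now ordered by `εn`, hence oppositely for the two signs of `ε`. A monomial whose germ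
lies below that of a sum either has larger value than some term, or has its left exponent between
those of two tied terms; the latter already forces the inequality in the composition, by extraction
of roots (`monomial_add_of_between`). So the germ map is injective (`injective_of_germ`). The same
argument embeds `Id_ε ∘ Ψ(λλ')` with the same generators. -/

namespace ArithmeticSite

universe u v

/-! ### Cancellative idempotent semirings -/

/-- A commutative semiring with `1 + 1 = 1` is idempotent. -/
abbrev idemCommSemiring {R : Type u} [CommSemiring R] (h : (1 : R) + 1 = 1) :
    IdemCommSemiring R :=
  { ‹CommSemiring R›, IdemSemiring.ofSemiring (fun a : R => by
      have := congrArg (a * ·) h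
      simpa [mul_add] using this) with }

section Idem

variable {K : Type u} [IdemCommSemiring K]

theorem ne_zero_of_le {a b : K} (h : a ≤ b) (ha : a ≠ 0) : b ≠ 0 := by
  rintro rfl
  exact ha (le_antisymm h zero_le)

variable [IsCancelMulZero K]

theorem le_of_mul_le_mul_of_ne_zero {s a b : K} (hs : s ≠ 0) (h : s * a ≤ s * b) : a ≤ b := by
  rw [← add_eq_right_iff_le] at h ⊢
  rw [← mul_add] at h
  exact mul_left_cancel₀ hs h

/-- Powers reflect the order in a cancellative idempotent semiring. -/
theorem le_of_pow_le_pow_of_ne_zero [Nontrivial K] {u v : K} (hv : v ≠ 0) {N : ℕ}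
    (hN : N ≠ 0) (h : u ^ N ≤ v ^ N) : u ≤ v := by
  obtain ⟨N, rfl⟩ := Nat.exists_eq_succ_of_ne_zero hN
  -- The products `s * u` and `s * v` share every term except `u^(N+1)` and `v^(N+1)`, so `s * u ≤ s
  -- * v`. The factor `s` can be cancelled because it dominates `v^N ≠ 0`.
  set s := ∑ i ∈ Finset.range (N + 1), u ^ i * v ^ (N - i) with hs
  have hvs : v ^ N ≤ s := by
    rw [hs, Finset.sum_range_succ']
    simp
  refine le_of_mul_le_mul_of_ne_zero (ne_zero_of_le hvs (pow_ne_zero N hv)) ?_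
  have h1 : s * u = ∑ i ∈ Finset.range N, u ^ (i + 1) * v ^ (N - i) + u ^ (N + 1) := by
    rw [hs, Finset.sum_mul, Finset.sum_range_succ]
    congr 1
    · exact Finset.sum_congr rfl fun i _ => by ring
    · simp [pow_succ]
  have h2 : s * v = ∑ i ∈ Finset.range N, u ^ (i + 1) * v ^ (N - i) + v ^ (N + 1) := by
    rw [hs, Finset.sum_mul, Finset.sum_range_succ']
    congr 1
    · refine Finset.sum_congr rfl fun i hi => ?_
      have : N - i = N - (i + 1) + 1 := by have := Finset.mem_range.1 hi; omega
      rw [this, pow_succ]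
      ring
    · simp [pow_succ]
  rw [h1, h2]
  exact add_le_add le_rfl h

/-- If `w ^ (a + b) = u ^ a * v ^ b`, then `w` lies below the supremum of `u` and `v`. -/
theorem le_add_of_pow_eq [Nontrivial K] {u v w : K} (hu : u ≠ 0) {a b : ℕ} (hab : a + b ≠ 0)
    (h : w ^ (a + b) = u ^ a * v ^ b) : w ≤ u + v := by
  -- Both `u` and `v` are at most `u + v`, hence `u^a v^b ≤ (u + v)^(a+b)`.
  refine le_of_pow_le_pow_of_ne_zero (ne_zero_of_le le_self_add hu) hab ?_
  rw [h, pow_add]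
  exact mul_le_mul' (pow_le_pow_left' le_self_add a) (pow_le_pow_left' le_add_self b)

/-- Composition of two strict comparison rules for monomials. -/
theorem monomial_le_of_lt [Nontrivial K] {X T Y : K} (hX : X ≠ 0) (hT : T ≠ 0) (hY : Y ≠ 0)
    {s t : ℝ} (ht : 0 < t)
    (hXT : ∀ n k n' k' : ℕ, s * n + k < s * n' + k' → X ^ n' * T ^ k' ≤ X ^ n * T ^ k)
    (hTY : ∀ k m k' m' : ℕ, t * k + m < t * k' + m' → T ^ k' * Y ^ m' ≤ T ^ k * Y ^ m)
    {n m n' m' : ℕ} (h : s * t * n + m < s * t * n' + m') :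
    X ^ n' * Y ^ m' ≤ X ^ n * Y ^ m := by
  -- The hypothesis says that `(m - m')/t < s (n' - n)`. Scaling by a large `N` makes this gap
  -- longer than 1, so that an integer `d` fits strictly inside.
  have hpos : 0 < s * (n' - n) - ((m : ℝ) - m') / t := by
    rw [sub_pos, div_lt_iff₀ ht]
    linarith
  obtain ⟨N, hN⟩ := exists_nat_gt (1 / (s * (n' - n) - ((m : ℝ) - m') / t))
  rw [div_lt_iff₀ hpos] at hN
  have hN0 : N ≠ 0 := by
    rintro rfl
    norm_num at hN
  set d : ℤ := ⌊(N : ℝ) * (((m : ℝ) - m') / t)⌋ + 1 with hd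
  have hd1 : (N : ℝ) * (((m : ℝ) - m') / t) < d := by
    rw [hd]; push_cast; exact Int.lt_floor_add_one _
  have hd2 : (d : ℝ) < N * (s * (n' - n)) := by
    have := Int.floor_le ((N : ℝ) * (((m : ℝ) - m') / t))
    rw [hd]; push_cast; nlinarith
  -- `T` has only natural exponents, so a possibly negative `d` is split between the two sides. The
  -- resulting factor `T^k T^k'` is cancelled at the end, and then an `N`-th root is taken.
  obtain ⟨k, k', hk⟩ : ∃ k k' : ℕ, d = k' - k := ⟨(-d).toNat, d.toNat, by omega⟩
  have hk' : (d : ℝ) = k' - k := by rw [hk]; push_cast; ring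
  rw [hk'] at hd1 hd2
  have e1 := hXT (N * n) k' (N * n') k (by push_cast; nlinarith)
  have e2 := hTY k (N * m) k' (N * m') (by
    have : (N : ℝ) * (((m : ℝ) - m') / t) * t = N * (m - m') := by field_simp
    have := mul_lt_mul_of_pos_right hd1 ht
    push_cast; nlinarith)
  refine le_of_pow_le_pow_of_ne_zero (mul_ne_zero (pow_ne_zero n hX) (pow_ne_zero m hY)) hN0
    (le_of_mul_le_mul_of_ne_zero (mul_ne_zero (pow_ne_zero k hT) (pow_ne_zero k' hT)) ?_)
  calc T ^ k * T ^ k' * (X ^ n' * Y ^ m') ^ N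
      = (X ^ (N * n') * T ^ k) * (T ^ k' * Y ^ (N * m')) := by rw [mul_pow]; ring
    _ ≤ (X ^ (N * n) * T ^ k') * (T ^ k * Y ^ (N * m)) := mul_le_mul' e1 e2
    _ = T ^ k * T ^ k' * (X ^ n * Y ^ m) ^ N := by rw [mul_pow]; ring

end Idem

/-! ### Morphisms out of `ℤ_min^+` -/

theorem ZMinPlus.eq_zero_or_eq_pow (z : ZMinPlus) :
    z = 0 ∨ ∃ n : ℕ, z = (Tropical.trop 1 : ZMinPlus) ^ n := by
  induction z using Tropical.tropRec with
  | _ z =>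
    rcases eq_or_ne z ⊤ with rfl | hz
    · exact Or.inl rfl
    · obtain ⟨n, rfl⟩ := ENat.ne_top_iff_exists.1 hz
      exact Or.inr ⟨n, by rw [← Tropical.trop_nsmul]; simp⟩

theorem ZMinPlus.trop_one_ne_zero : (Tropical.trop 1 : ZMinPlus) ≠ 0 := fun h =>
  ENat.one_ne_top (congrArg Tropical.untrop h)

theorem ZMinPlus.hom_ext {R : Type u} [CommSemiring R] {f g : ZMinPlus →+* R}
    (h : f (Tropical.trop 1) = g (Tropical.trop 1)) : f = g := by
  ext z
  rcases ZMinPlus.eq_zero_or_eq_pow z with rfl | ⟨n, rfl⟩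
  · rw [map_zero, map_zero]
  · rw [map_pow, map_pow, h]

/-! ### Generators of a reduced correspondence -/

namespace ReducedCorrespondence

variable (C D : ReducedCorrespondence.{u})

/-- The image of the generator `q` under the left morphism. -/
noncomputable def genLeft : C.carrier := C.left (Tropical.trop 1)

/-- The image of the generator `q` under the right morphism. -/
noncomputable def genRight : C.carrier := C.right (Tropical.trop 1)

/-- The monomial `ℓ(q)^n r(q)^m`. -/
noncomputable def monomial (n m : ℕ) : C.carrier := C.genLeft ^ n * C.genRight ^ m

variable {C} in
theorem left_eq_zero {x : ZMinPlus} (h : C.left x = 0) : x = 0 := by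
  have : x ∈ C.left ⁻¹' {0} := h
  rwa [C.left_preimage_zero] at this

variable {C} in
theorem right_eq_zero {x : ZMinPlus} (h : C.right x = 0) : x = 0 := by
  have : x ∈ C.right ⁻¹' {0} := h
  rwa [C.right_preimage_zero] at this

theorem genLeft_ne_zero : C.genLeft ≠ 0 := fun h => ZMinPlus.trop_one_ne_zero (left_eq_zero h)

theorem genRight_ne_zero : C.genRight ≠ 0 := fun h => ZMinPlus.trop_one_ne_zero (right_eq_zero h)

theorem monomial_ne_zero (n m : ℕ) : C.monomial n m ≠ 0 :=
  mul_ne_zero (pow_ne_zero n C.genLeft_ne_zero) (pow_ne_zero m C.genRight_ne_zero)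

/-- Every element of a reduced correspondence is a sum of monomials. -/
theorem monomial_induction {p : C.carrier → Prop} (zero : p 0)
    (monomial : ∀ n m, p (C.monomial n m)) (add : ∀ a b, p a → p b → p (a + b))
    (a : C.carrier) : p a := by
  have ha : a ∈ Subsemiring.closure {z : C.carrier | ∃ x y, z = C.left x * C.right y} := by
    rw [C.generated]; trivial
  -- The closure is the additive closure of the multiplicative closure, and the latter contains only
  -- zero and monomials.
  rw [Subsemiring.mem_closure_iff] at ha
  induction ha using AddSubmonoid.closure_induction with
  | zero => exact zero
  | add a b _ _ ha hb => exact add a b ha hb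
  | mem a ha =>
    have : a = 0 ∨ ∃ n m, a = C.monomial n m := by
      induction ha using Submonoid.closure_induction with
      | one => exact Or.inr ⟨0, 0, by simp [ReducedCorrespondence.monomial]⟩
      | mem a ha =>
        obtain ⟨x, y, rfl⟩ := ha
        rcases ZMinPlus.eq_zero_or_eq_pow x with rfl | ⟨n, rfl⟩
        · left; simp
        rcases ZMinPlus.eq_zero_or_eq_pow y with rfl | ⟨m, rfl⟩
        · left; simp
        exact Or.inr ⟨n, m, by rw [map_pow, map_pow]; rfl⟩
      | mul a b _ _ ha hb =>
        rcases ha with rfl | ⟨n, m, rfl⟩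
        · left; simp
        rcases hb with rfl | ⟨n', m', rfl⟩
        · left; simp
        exact Or.inr ⟨n + n', m + m', by
          simp only [ReducedCorrespondence.monomial, pow_add]; ring⟩
    rcases this with rfl | ⟨n, m, rfl⟩
    · exact zero
    · exact monomial n m

variable {C D}

/-- A morphism that reflects the order between monomials and arbitrary elements is injective. -/
theorem injective_of_monomial {G : Type v} [CommSemiring G] (h11 : (1 : G) + 1 = 1)
    (f : C.carrier →+* G)
    (h : ∀ n m b, f (C.monomial n m) + f b = f b → C.monomial n m + b = b) :
    Function.Injective f := by
  let _ := idemCommSemiring h11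
  -- A sum lies below `b` exactly when both summands do, so reflection of the order passes from
  -- monomials to all elements. Equality is a pair of inequalities.
  have key : ∀ a b, f a + f b = f b → a + b = b := by
    intro a b
    induction a using C.monomial_induction with
    | zero => intro _; simp
    | monomial n m => exact h n m b
    | add a a' ha ha' =>
      intro hab
      have hle : f a + f a' ≤ f b := by
        rw [← add_eq_right_iff_le, ← map_add]; exact hab
      rw [add_assoc, ha' (add_eq_right_iff_le.2 (le_add_self.trans hle)),
        ha (add_eq_right_iff_le.2 (le_self_add.trans hle))]
  intro a b hab
  have hid : f b + f b = f b := add_idem _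
  have h1 := key a b (by rw [hab, hid])
  have h2 := key b a (by rw [hab, hid])
  rw [← h1, add_comm, h2]

/-- Two reduced correspondences embedded compatibly in the same semiring are equal. -/
theorem equal_of_injective {G : Type v} [CommSemiring G] (f : C.carrier →+* G)
    (g : D.carrier →+* G) (hf : Function.Injective f) (hg : Function.Injective g)
    (hl : f C.genLeft = g D.genLeft) (hr : f C.genRight = g D.genRight) : C.Equal D := by
  have hl' : f.comp C.left = g.comp D.left := ZMinPlus.hom_ext hl
  have hr' : f.comp C.right = g.comp D.right := ZMinPlus.hom_ext hr
  have hmon : ∀ n m, f (C.monomial n m) = g (D.monomial n m) := fun n m => by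
    simp only [monomial, map_mul, map_pow, hl, hr]
  -- Both images consist of the sums of the same monomials, so they coincide. Injectivity then makes
  -- the chosen partners multiplicative and additive.
  have h1 : ∀ a, ∃ b, g b = f a := fun a => by
    induction a using C.monomial_induction with
    | zero => exact ⟨0, by simp⟩
    | monomial n m => exact ⟨_, (hmon n m).symm⟩
    | add a a' ha ha' =>
      obtain ⟨b, hb⟩ := ha
      obtain ⟨b', hb'⟩ := ha'
      exact ⟨b + b', by simp [hb, hb']⟩
  have h2 : ∀ b, ∃ a, f a = g b := fun a => by
    induction a using D.monomial_induction with
    | zero => exact ⟨0, by simp⟩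
    | monomial n m => exact ⟨_, hmon n m⟩
    | add a a' ha ha' =>
      obtain ⟨b, hb⟩ := ha
      obtain ⟨b', hb'⟩ := ha'
      exact ⟨b + b', by simp [hb, hb']⟩
  choose i hi using h1
  choose j hj using h2
  let e : C.carrier ≃+* D.carrier :=
    { toFun := i
      invFun := j
      left_inv := fun a => hf (by rw [hj, hi])
      right_inv := fun b => hg (by rw [hi, hj])
      map_mul' := fun a b => hg (by rw [hi, map_mul, map_mul, hi, hi])
      map_add' := fun a b => hg (by rw [hi, map_add, map_add, hi, hi]) }
  exact ⟨e, fun x => hg ((hi _).trans (RingHom.congr_fun hl' x)),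
    fun x => hg ((hi _).trans (RingHom.congr_fun hr' x))⟩

/-! ### Morphisms into and out of a composition -/

/-- The morphism from the first factor to the cancellative reduction of the tensor product. -/
noncomputable def inclLeft (C D : ReducedCorrespondence.{u}) :
    C.carrier →+* CancelReduction (Tensor C D) :=
  (cancelCon (Tensor C D)).mk'.comp
    ((Algebra.TensorProduct.includeLeftRingHom).comp C.toViaRight.toRingHom)

/-- The morphism from the second factor to the cancellative reduction of the tensor product. -/
noncomputable def inclRight (C D : ReducedCorrespondence.{u}) :
    D.carrier →+* CancelReduction (Tensor C D) :=
  (cancelCon (Tensor C D)).mk'.comp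
    ((Algebra.TensorProduct.includeRight.toRingHom).comp D.toViaLeft.toRingHom)

/-- The balancing relation of the tensor product: the middle generator `T` can be read in either
factor. It is the link through which comparisons in the two factors combine. -/
theorem inclLeft_right (x : ZMinPlus) :
    inclLeft C D (C.right x) = inclRight C D (D.left x) := by
  have h : algebraMap ZMinPlus C.ViaRight x ⊗ₜ[ZMinPlus] (1 : D.ViaLeft) =
      (1 : C.ViaRight) ⊗ₜ[ZMinPlus] algebraMap ZMinPlus D.ViaLeft x := by
    rw [Algebra.algebraMap_eq_smul_one, Algebra.algebraMap_eq_smul_one,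
      TensorProduct.smul_tmul]
  exact congrArg (cancelCon (Tensor C D)).mk' h

/-- The underlying element of the cancellative reduction. -/
noncomputable def compIncl (C D : ReducedCorrespondence.{u}) :
    (C.comp D).carrier →+* CancelReduction (Tensor C D) :=
  Subsemiring.subtype
    (Subsemiring.closure (Set.range (tensorLeft C D) ∪ Set.range (tensorRight C D)))

theorem compIncl_injective : Function.Injective (compIncl C D) := Subtype.val_injective

theorem compIncl_genLeft : compIncl C D (C.comp D).genLeft = inclLeft C D C.genLeft := rfl

theorem compIncl_genRight : compIncl C D (C.comp D).genRight = inclRight C D D.genRight := rfl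

theorem compIncl_monomial (n m : ℕ) : compIncl C D ((C.comp D).monomial n m) =
    inclLeft C D C.genLeft ^ n * inclRight C D D.genRight ^ m := by
  simp only [monomial, map_mul, map_pow, compIncl_genLeft, compIncl_genRight]

theorem inclLeft_ne_zero {a : C.carrier} (ha : a ≠ 0) : inclLeft C D a ≠ 0 := fun h =>
  (tmul_eq_zero C D (cancelCon_mk_eq_zero.1 h)).elim ha one_ne_zero

theorem inclRight_ne_zero {a : D.carrier} (ha : a ≠ 0) : inclRight C D a ≠ 0 := fun h =>
  (tmul_eq_zero C D (cancelCon_mk_eq_zero.1 h)).elim one_ne_zero ha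

/-- The universal property of the composition, for pairs of morphisms whose nonzero values satisfy
a predicate that is stable under sums and products and implies cancellability. -/
theorem exists_comp_hom {G : Type u} [CommSemiring G] (P : G → Prop)
    (hadd : ∀ x y, P x → P y → P (x + y)) (hmul : ∀ x y, P x → P y → P (x * y))
    (hcancel : ∀ x y z, P x → x * y = x * z → y = z)
    (f : C.carrier →+* G) (g : D.carrier →+* G)
    (hf : ∀ a, a ≠ 0 → P (f a)) (hg : ∀ a, a ≠ 0 → P (g a))
    (hfg : f C.genRight = g D.genLeft) :
    ∃ F : (C.comp D).carrier →+* G,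
      F (C.comp D).genLeft = f C.genLeft ∧ F (C.comp D).genRight = g D.genRight := by
  have hfg' : f.comp C.right = g.comp D.left := ZMinPlus.hom_ext hfg
  let _ : Algebra ZMinPlus G := (f.comp C.right).toAlgebra
  let f' : C.ViaRight →ₐ[ZMinPlus] G :=
    { f.comp C.toViaRight.symm.toRingHom with commutes' := fun _ => rfl }
  let g' : D.ViaLeft →ₐ[ZMinPlus] G :=
    { g.comp D.toViaLeft.symm.toRingHom with
      commutes' := fun x => (RingHom.congr_fun hfg' x).symm }
  let F : Tensor C D →+* G := (Algebra.TensorProduct.productMap f' g').toRingHom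
  have hFt : ∀ a b, F (a ⊗ₜ b) = f' a * g' b := fun a b => by simp [F]
  -- `G` itself need not be cancellative; germs, for example, have zero divisors. For `F` to descend
  -- to the reduction it suffices that nonzero tensors, being sums of pure tensors with nonzero
  -- factors, go to cancellable elements.
  have hP : ∀ t : Tensor C D, t = 0 ∨ P (F t) := by
    intro t
    induction t using TensorProduct.induction_on with
    | zero => exact Or.inl rfl
    | tmul a b =>
      by_cases ha : a = 0
      · left; rw [ha, TensorProduct.zero_tmul]
      by_cases hb : b = 0
      · left; rw [hb, TensorProduct.tmul_zero]
      right
      rw [hFt]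
      exact hmul _ _ (hf a ha) (hg b hb)
    | add x y hx hy =>
      rcases hx with rfl | hx
      · simpa using hy
      rcases hy with rfl | hy
      · simpa using Or.inr hx
      right
      rw [map_add]
      exact hadd _ _ hx hy
  let F' : CancelReduction (Tensor C D) →+* G := (cancelCon (Tensor C D)).lift F (by
    rintro a b ⟨c, hc, h⟩
    refine hcancel (F c) _ _ ((hP c).resolve_left hc) ?_
    rw [← map_mul, ← map_mul, h])
  refine ⟨F'.comp (compIncl C D), ?_, ?_⟩
  · exact (hFt (C.toViaRight C.genLeft) 1).trans (by rw [map_one, mul_one]; rfl)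
  · exact (hFt 1 (D.toViaLeft D.genRight)).trans (by rw [map_one, one_mul]; rfl)

/-- Strict comparison rules for monomials are inherited by compositions. -/
theorem comp_monomial_add_of_lt {s t : ℝ} (ht : 0 < t)
    (hC : ∀ n m n' m' : ℕ, s * n + m < s * n' + m' →
      C.monomial n' m' + C.monomial n m = C.monomial n m)
    (hD : ∀ n m n' m' : ℕ, t * n + m < t * n' + m' →
      D.monomial n' m' + D.monomial n m = D.monomial n m)
    {n m n' m' : ℕ} (h : s * t * n + m < s * t * n' + m') :
    (C.comp D).monomial n' m' + (C.comp D).monomial n m = (C.comp D).monomial n m := by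
  have h11 : (1 : CancelReduction (Tensor C D)) + 1 = 1 := by
    rw [← map_one (inclLeft C D), ← map_add, C.one_add_one]
  have hT : inclLeft C D C.genRight = inclRight C D D.genLeft := inclLeft_right _
  have : Nontrivial (CancelReduction (Tensor C D)) :=
    ⟨⟨_, 0, inclLeft_ne_zero C.genLeft_ne_zero⟩⟩
  let _ := idemCommSemiring h11
  apply compIncl_injective
  rw [map_add, compIncl_monomial, compIncl_monomial, add_eq_right_iff_le]
  refine monomial_le_of_lt (T := inclLeft C D C.genRight)
    (inclLeft_ne_zero C.genLeft_ne_zero) (inclLeft_ne_zero C.genRight_ne_zero)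
    (inclRight_ne_zero D.genRight_ne_zero) ht ?_ ?_ h
  · intro n k n' k' hlt
    have := congrArg (inclLeft C D) (hC n k n' k' hlt)
    rw [map_add] at this
    simpa only [monomial, map_mul, map_pow] using add_eq_right_iff_le.1 this
  · intro n k n' k' hlt
    have := congrArg (inclRight C D) (hD n k n' k' hlt)
    rw [map_add] at this
    rw [hT]
    simpa only [monomial, map_mul, map_pow] using add_eq_right_iff_le.1 this

/-- If a power of `ℓ(q)` is a power of `r(q)` in the first factor, then equalities of monomials in
the second factor yield comparisons in the composition. -/
theorem comp_monomial_add_of_eq {a b : ℕ} (hb : b ≠ 0)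
    (hC : C.genLeft ^ b = C.genRight ^ a) {n m n' m' : ℕ}
    (hD : D.monomial (a * n') (b * m') = D.monomial (a * n) (b * m)) :
    (C.comp D).monomial n' m' + (C.comp D).monomial n m = (C.comp D).monomial n m := by
  have hT : inclLeft C D C.genRight = inclRight C D D.genLeft := inclLeft_right _
  let _ := idemCommSemiring (C.comp D).one_add_one
  rw [add_eq_right_iff_le]
  refine le_of_pow_le_pow_of_ne_zero ((C.comp D).monomial_ne_zero n m) hb (le_of_eq ?_)
  -- Since `X^b = T^a`, the power `(X^n Y^m)^b` equals `T^(an) Y^(bm)` and so comes from the second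
  -- factor.
  have key : ∀ n m, compIncl C D ((C.comp D).monomial n m ^ b) =
      inclRight C D (D.monomial (a * n) (b * m)) := by
    intro n m
    rw [map_pow, compIncl_monomial, mul_pow, ← pow_mul, mul_comm n b, pow_mul, ← map_pow, hC,
      map_pow, hT, ← pow_mul, ← pow_mul, mul_comm m b]
    simp only [monomial, map_mul, map_pow]
  apply compIncl_injective
  rw [key, key, hD]

end ReducedCorrespondence

/-! ### Arithmetic of `ℝ_+^max` -/

namespace RMax

theorem qpow_mul_qpow {q : ℝ≥0} (hq0 : 0 < q) (s t : ℝ) :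
    qpow q s * qpow q t = qpow q (s + t) := by
  ext1
  exact (NNReal.rpow_add hq0.ne' s t).symm

theorem qpow_pow {q : ℝ≥0} (hq0 : 0 < q) (s : ℝ) (n : ℕ) : qpow q s ^ n = qpow q (s * n) := by
  induction n with
  | zero => ext1; simp [qpow]
  | succ n ih =>
    rw [pow_succ, ih, qpow_mul_qpow hq0]
    congr 1
    push_cast
    ring

theorem qpow_pow_mul_qpow_pow {q : ℝ≥0} (hq0 : 0 < q) (s t : ℝ) (n m : ℕ) :
    qpow q s ^ n * qpow q t ^ m = qpow q (s * n + t * m) := by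
  rw [qpow_pow hq0, qpow_pow hq0, qpow_mul_qpow hq0]

theorem qpow_add_qpow {q : ℝ≥0} (hq0 : 0 < q) (hq1 : q < 1) {s t : ℝ} :
    qpow q t + qpow q s = qpow q s ↔ s ≤ t := by
  rw [RMax.ext_iff, val_add, max_eq_right_iff]
  exact Real.rpow_le_rpow_left_iff_of_base_lt_one (x := q) hq0 hq1

theorem qpow_injective {q : ℝ≥0} (hq0 : 0 < q) (hq1 : q < 1) : Function.Injective (qpow q) := by
  intro s t h
  have hid : qpow q s + qpow q s = qpow q s := (qpow_add_qpow hq0 hq1).2 le_rfl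
  exact le_antisymm ((qpow_add_qpow hq0 hq1).1 (h ▸ hid)) ((qpow_add_qpow hq0 hq1).1 (h ▸ hid))

theorem add_eq_or (a b : RMax) : a + b = a ∨ a + b = b := by
  rcases le_total a.val b.val with h | h
  · exact Or.inr (RMax.ext (max_eq_right h))
  · exact Or.inl (RMax.ext (max_eq_left h))

theorem add_ne_zero_of_left {a b : RMax} (ha : a ≠ 0) : a + b ≠ 0 := by
  intro h
  have h2 : max a.val b.val = 0 := congrArg RMax.val h
  exact ha (RMax.ext (le_antisymm ((le_max_left _ _).trans h2.le) zero_le))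

theorem mul_ne_zero_of_ne {a b : RMax} (ha : a ≠ 0) (hb : b ≠ 0) : a * b ≠ 0 := fun h =>
  hb (mul_left_cancel_of_ne ha (h.trans (mul_zero a).symm))

/-- The automorphism `x ↦ x^s` of `ℝ_+^max`, for `s > 0`. -/
noncomputable def rpowHom (s : ℝ) (hs : 0 < s) : RMax →+* RMax where
  toFun x := ⟨x.val ^ s⟩
  map_zero' := by ext1; simp [NNReal.zero_rpow hs.ne']
  map_one' := by ext1; simp
  map_mul' a b := by ext1; simp [NNReal.mul_rpow]
  map_add' a b := by
    ext1
    exact (NNReal.monotone_rpow_of_nonneg hs.le).map_max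

theorem rpowHom_qpow (s : ℝ) (hs : 0 < s) (q : ℝ≥0) (t : ℝ) :
    rpowHom s hs (qpow q t) = qpow q (t * s) := by
  ext1
  exact (NNReal.rpow_mul q t s).symm

theorem rpowHom_ne_zero (s : ℝ) (hs : 0 < s) {a : RMax} (ha : a ≠ 0) : rpowHom s hs a ≠ 0 := by
  intro h
  have h1 : a.val ^ s = 0 := congrArg RMax.val h
  exact ha (RMax.ext ((NNReal.rpow_eq_zero hs.ne').1 h1))

end RMax

/-! ### Correspondences with values in `ℝ_+^max` -/

/-- A morphism to `ℝ_+^max` which identifies the order of the monomials with the order of their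
values is injective. -/
theorem ReducedCorrespondence.injective_of_rMax {C : ReducedCorrespondence.{u}} {q : ℝ≥0}
    (hq0 : 0 < q) (hq1 : q < 1) {s : ℝ} (f : C.carrier →+* RMax)
    (hl : f C.genLeft = RMax.qpow q s) (hr : f C.genRight = RMax.qpow q 1)
    (h : ∀ n m n' m' : ℕ, s * n + m ≤ s * n' + m' →
      C.monomial n' m' + C.monomial n m = C.monomial n m) :
    Function.Injective f := by
  have hmon : ∀ n m, f (C.monomial n m) = RMax.qpow q (s * n + m) := fun n m => by
    simp only [ReducedCorrespondence.monomial, map_mul, map_pow, hl, hr,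
      RMax.qpow_pow_mul_qpow_pow hq0, one_mul]
  -- `RMax` is totally ordered, so the value of a sum is attained by one of its terms. This reduces
  -- a comparison with `b` to one with a single monomial.
  refine injective_of_monomial RMax.one_add_one f fun n m b => ?_
  induction b using C.monomial_induction with
  | zero =>
    intro h0
    rw [map_zero, add_zero, hmon] at h0
    exact absurd h0 (RMax.qpow_ne_zero hq0 _)
  | monomial n' m' =>
    rw [hmon, hmon, RMax.qpow_add_qpow hq0 hq1]
    exact h n' m' n m
  | add b b' hb hb' =>
    rw [map_add]
    intro hle
    rcases RMax.add_eq_or (f b) (f b') with h1 | h1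
    · rw [h1] at hle
      rw [← add_assoc, hb hle]
    · rw [h1] at hle
      rw [add_left_comm, hb' hle]

/-! ### Composition of Frobenius correspondences through real values -/

section Frobenius

variable (q : ℝ≥0) (hq0 : 0 < q) (hq1 : q < 1) (lam : ℝ) (hlam : 0 < lam)

/-- The inclusion of `𝓡(λ)` in `ℝ_+^max`. -/
noncomputable def frobIncl : (frobenius q hq0 hq1 lam hlam).carrier →+* RMax :=
  Subsemiring.subtype (frobF q hq1 lam hlam).rangeS

theorem frobIncl_injective : Function.Injective (frobIncl q hq0 hq1 lam hlam) :=
  Subtype.val_injective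

theorem frobIncl_ne_zero (a : (frobenius q hq0 hq1 lam hlam).carrier) (ha : a ≠ 0) :
    frobIncl q hq0 hq1 lam hlam a ≠ 0 := fun h =>
  ha (frobIncl_injective q hq0 hq1 lam hlam (h.trans (map_zero _).symm))

theorem frobIncl_genLeft :
    frobIncl q hq0 hq1 lam hlam (frobenius q hq0 hq1 lam hlam).genLeft = RMax.qpow q lam := by
  change frobF q hq1 lam hlam (Tropical.trop 1 ⊗ₜ 1) = _
  simp [frobF, scaleHom, powHom_trop_one]

theorem frobIncl_genRight :
    frobIncl q hq0 hq1 lam hlam (frobenius q hq0 hq1 lam hlam).genRight = RMax.qpow q 1 := by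
  change frobF q hq1 lam hlam (1 ⊗ₜ Tropical.trop 1) = _
  simp [frobF, scaleHom, powHom_trop_one]

theorem frobIncl_monomial (n m : ℕ) :
    frobIncl q hq0 hq1 lam hlam ((frobenius q hq0 hq1 lam hlam).monomial n m) =
      RMax.qpow q (lam * n + m) := by
  rw [ReducedCorrespondence.monomial, map_mul, map_pow, map_pow, frobIncl_genLeft,
    frobIncl_genRight, RMax.qpow_pow_mul_qpow_pow hq0, one_mul]

/-- As `q < 1`, the larger exponent gives the smaller element. Within a single `𝓡(λ)` ties cause no
trouble, because they are equalities. -/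
theorem frobenius_monomial_add (n m n' m' : ℕ) (h : lam * n + m ≤ lam * n' + m') :
    (frobenius q hq0 hq1 lam hlam).monomial n' m' + (frobenius q hq0 hq1 lam hlam).monomial n m =
      (frobenius q hq0 hq1 lam hlam).monomial n m := by
  apply frobIncl_injective
  rw [map_add, frobIncl_monomial, frobIncl_monomial]
  exact (RMax.qpow_add_qpow hq0 hq1).2 h

/-- The value map `q^a ⊗ q^b ↦ q^(λ' a + b)` on a composition of Frobenius correspondences. -/
theorem exists_frobenius_comp_hom (lam' : ℝ) (hlam' : 0 < lam') :
    ∃ F : ((frobenius q hq0 hq1 lam hlam).comp (frobenius q hq0 hq1 lam' hlam')).carrier →+* RMax,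
      F (ReducedCorrespondence.genLeft _) = RMax.qpow q (lam * lam') ∧
      F (ReducedCorrespondence.genRight _) = RMax.qpow q 1 := by
  -- The automorphism `x ↦ x^λ'` rescales the first factor so that its right generator `q` meets the
  -- left generator `q^λ'` of the second.
  obtain ⟨F, hl, hr⟩ := ReducedCorrespondence.exists_comp_hom (fun x : RMax => x ≠ 0)
    (fun x y hx _ => RMax.add_ne_zero_of_left hx) (fun x y => RMax.mul_ne_zero_of_ne)
    (fun x y z => RMax.mul_left_cancel_of_ne)
    ((RMax.rpowHom lam' hlam').comp (frobIncl q hq0 hq1 lam hlam))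
    (frobIncl q hq0 hq1 lam' hlam')
    (fun a ha => RMax.rpowHom_ne_zero lam' hlam' (frobIncl_ne_zero q hq0 hq1 lam hlam a ha))
    (frobIncl_ne_zero q hq0 hq1 lam' hlam')
    (by rw [RingHom.comp_apply, frobIncl_genRight, frobIncl_genLeft, RMax.rpowHom_qpow, one_mul])
  refine ⟨F, ?_, ?_⟩
  · rw [hl, RingHom.comp_apply, frobIncl_genLeft, RMax.rpowHom_qpow]
  · rw [hr, frobIncl_genRight]

/-- The composition of two Frobenius correspondences is the Frobenius correspondence of the product
of the parameters, as soon as monomials of equal value are comparable. -/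
theorem frobenius_comp_equal (lam' : ℝ) (hlam' : 0 < lam')
    (h : ∀ n m n' m' : ℕ, lam * lam' * n + m = lam * lam' * n' + m' →
      ((frobenius q hq0 hq1 lam hlam).comp (frobenius q hq0 hq1 lam' hlam')).monomial n' m' +
        ((frobenius q hq0 hq1 lam hlam).comp (frobenius q hq0 hq1 lam' hlam')).monomial n m =
        ((frobenius q hq0 hq1 lam hlam).comp (frobenius q hq0 hq1 lam' hlam')).monomial n m) :
    ((frobenius q hq0 hq1 lam hlam).comp (frobenius q hq0 hq1 lam' hlam')).Equal
      (frobenius q hq0 hq1 (lam * lam') (mul_pos hlam hlam')) := by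
  obtain ⟨F, hl, hr⟩ := exists_frobenius_comp_hom q hq0 hq1 lam hlam lam' hlam'
  refine ReducedCorrespondence.equal_of_injective F (frobIncl q hq0 hq1 _ _)
    (ReducedCorrespondence.injective_of_rMax hq0 hq1 F hl hr fun n m n' m' hle => ?_)
    (frobIncl_injective q hq0 hq1 _ _) (by rw [hl, frobIncl_genLeft])
    (by rw [hr, frobIncl_genRight])
  rcases hle.lt_or_eq with hlt | heq
  · exact ReducedCorrespondence.comp_monomial_add_of_lt hlam'
      (fun n m n' m' h => frobenius_monomial_add q hq0 hq1 lam hlam n m n' m' h.le)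
      (fun n m n' m' h => frobenius_monomial_add q hq0 hq1 lam' hlam' n m n' m' h.le) hlt
  · exact h n m n' m' heq

end Frobenius

theorem eq_of_irrational_mul_add {s : ℝ} (hs : Irrational s) {n m n' m' : ℕ}
    (h : s * n + m = s * n' + m') : n = n' ∧ m = m' := by
  have hn : n = n' := by
    by_contra hne
    have hne' : (n : ℝ) - n' ≠ 0 := sub_ne_zero.2 (by exact_mod_cast hne)
    refine hs ⟨((m' : ℚ) - m) / (n - n'), ?_⟩
    push_cast
    rw [div_eq_iff hne']
    linarith
  subst hn
  exact ⟨rfl, by exact_mod_cast add_left_cancel h⟩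

/-- Equal values force equal exponents, so the comparison of ties is only idempotence of addition.
-/
theorem frobenius_comp_equal_of_irrational (q : ℝ≥0) (hq0 : 0 < q) (hq1 : q < 1)
    (lam lam' : ℝ) (hlam : 0 < lam) (hlam' : 0 < lam') (hirr : Irrational (lam * lam')) :
    ((frobenius q hq0 hq1 lam hlam).comp (frobenius q hq0 hq1 lam' hlam')).Equal
      (frobenius q hq0 hq1 (lam * lam') (mul_pos hlam hlam')) := by
  refine frobenius_comp_equal q hq0 hq1 lam hlam lam' hlam' fun n m n' m' h => ?_
  obtain ⟨rfl, rfl⟩ := eq_of_irrational_mul_add hirr h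
  let _ := idemCommSemiring
    ((frobenius q hq0 hq1 lam hlam).comp (frobenius q hq0 hq1 lam' hlam')).one_add_one
  exact add_idem _

/-- With `λ = a/b` the relation `X^b = T^a` holds in `𝓡(λ)`. A tie between monomials of the
composition becomes, after `b`-th powers, a tie in `𝓡(λ')`, which is an equality there. -/
theorem frobenius_comp_equal_of_rational (q : ℝ≥0) (hq0 : 0 < q) (hq1 : q < 1)
    (lam lam' : ℝ) (hlam : 0 < lam) (hlam' : 0 < lam')
    (hrat : lam ∈ Set.range ((↑) : ℚ → ℝ)) :
    ((frobenius q hq0 hq1 lam hlam).comp (frobenius q hq0 hq1 lam' hlam')).Equal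
      (frobenius q hq0 hq1 (lam * lam') (mul_pos hlam hlam')) := by
  obtain ⟨a, b, hb, hab⟩ : ∃ a b : ℕ, b ≠ 0 ∧ lam * b = a := by
    obtain ⟨r, rfl⟩ := hrat
    have hr : 0 < r := by exact_mod_cast hlam
    have h1 : r * r.den = r.num := Rat.mul_den_eq_num r
    have h2 : ((r.num.toNat : ℤ) : ℚ) = r.num := by
      rw [Int.toNat_of_nonneg (Rat.num_pos.2 hr).le]
    refine ⟨r.num.toNat, r.den, r.den_nz, ?_⟩
    rw [← h2] at h1
    exact_mod_cast h1
  refine frobenius_comp_equal q hq0 hq1 lam hlam lam' hlam' fun n m n' m' h =>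
    ReducedCorrespondence.comp_monomial_add_of_eq (a := a) hb ?_ ?_
  · apply frobIncl_injective
    rw [map_pow, map_pow, frobIncl_genLeft, frobIncl_genRight, RMax.qpow_pow hq0,
      RMax.qpow_pow hq0, hab, one_mul]
  · apply frobIncl_injective
    rw [frobIncl_monomial, frobIncl_monomial]
    congr 1
    push_cast
    rw [← hab]
    linear_combination -(b : ℝ) * h

/-! ### Germs with values in `ℝ_+^max` -/

/-- The semiring of germs at `0 ∈ ℝ` of functions with values in `ℝ_+^max`. -/
abbrev RMaxGerm : Type := Filter.Germ (𝓝 (0 : ℝ)) RMax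

namespace RMaxGerm

theorem one_add_one : (1 : RMaxGerm) + 1 = 1 :=
  congrArg (fun f : ℝ → RMax => (f : RMaxGerm)) (funext fun _ => RMax.one_add_one)

/-- The germ of `ε ↦ q^(s(ε))`. -/
noncomputable def qpow (q : ℝ≥0) (s : ℝ → ℝ) : RMaxGerm :=
  ((fun e => RMax.qpow q (s e) : ℝ → RMax) : RMaxGerm)

theorem qpow_pow_mul_qpow_pow {q : ℝ≥0} (hq0 : 0 < q) (s t : ℝ → ℝ) (n m : ℕ) :
    qpow q s ^ n * qpow q t ^ m = qpow q (fun e => s e * n + t e * m) :=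
  congrArg (fun f : ℝ → RMax => (f : RMaxGerm))
    (funext fun _ => RMax.qpow_pow_mul_qpow_pow hq0 _ _ n m)

theorem qpow_add_qpow {q : ℝ≥0} (hq0 : 0 < q) (hq1 : q < 1) {s t : ℝ → ℝ}
    (h : ∀ᶠ e in 𝓝 0, s e ≤ t e) : qpow q t + qpow q s = qpow q s :=
  Filter.Germ.coe_eq.2 (h.mono fun _ he => (RMax.qpow_add_qpow hq0 hq1).2 he)

/-- The germ has no zero in a neighborhood of `0`. -/
def Nonvanishing (x : RMaxGerm) : Prop := x.LiftPred (· ≠ 0)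

theorem Nonvanishing.add {x y : RMaxGerm} (hx : Nonvanishing x) (_ : Nonvanishing y) :
    Nonvanishing (x + y) := by
  induction x using Filter.Germ.inductionOn with | _ f =>
  induction y using Filter.Germ.inductionOn with | _ g =>
  exact Filter.Eventually.mono hx fun e he => RMax.add_ne_zero_of_left he

theorem Nonvanishing.mul {x y : RMaxGerm} (hx : Nonvanishing x) (hy : Nonvanishing y) :
    Nonvanishing (x * y) := by
  induction x using Filter.Germ.inductionOn with | _ f =>
  induction y using Filter.Germ.inductionOn with | _ g =>
  exact (Filter.Eventually.and hx hy).mono fun e he => RMax.mul_ne_zero_of_ne he.1 he.2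

theorem Nonvanishing.mul_left_cancel {x y z : RMaxGerm} (hx : Nonvanishing x)
    (h : x * y = x * z) : y = z := by
  induction x using Filter.Germ.inductionOn with | _ f =>
  induction y using Filter.Germ.inductionOn with | _ g =>
  induction z using Filter.Germ.inductionOn with | _ k =>
  exact Filter.Germ.coe_eq.2 ((Filter.Eventually.and hx (Filter.Germ.coe_eq.1 h)).mono
    fun e he => RMax.mul_left_cancel_of_ne he.1 he.2)

theorem nonvanishing_qpow {q : ℝ≥0} (hq0 : 0 < q) (s : ℝ → ℝ) : Nonvanishing (qpow q s) :=
  Filter.Eventually.of_forall fun e => RMax.qpow_ne_zero hq0 (s e)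

/-- Constant germs. -/
noncomputable def constHom : RMax →+* RMaxGerm :=
  (Filter.Germ.coeRingHom (𝓝 (0 : ℝ))).comp (Pi.constRingHom ℝ RMax)

theorem constHom_qpow (q : ℝ≥0) (s : ℝ) : constHom (RMax.qpow q s) = qpow q fun _ => s := rfl

theorem constHom_nonvanishing {a : RMax} (ha : a ≠ 0) : Nonvanishing (constHom a) :=
  Filter.Eventually.of_forall fun _ => ha

/-- A semiring endomorphism of `ℝ_+^max` applied to germs. -/
noncomputable def mapHom (θ : RMax →+* RMax) : RMaxGerm →+* RMaxGerm where
  toFun := Filter.Germ.map θ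
  map_zero' := congrArg (fun f : ℝ → RMax => (f : RMaxGerm)) (funext fun _ => map_zero θ)
  map_one' := congrArg (fun f : ℝ → RMax => (f : RMaxGerm)) (funext fun _ => map_one θ)
  map_mul' x y := Filter.Germ.inductionOn₂ x y fun _ _ =>
    congrArg (fun f : ℝ → RMax => (f : RMaxGerm)) (funext fun _ => map_mul θ _ _)
  map_add' x y := Filter.Germ.inductionOn₂ x y fun _ _ =>
    congrArg (fun f : ℝ → RMax => (f : RMaxGerm)) (funext fun _ => map_add θ _ _)

theorem mapHom_rpowHom_qpow (s : ℝ) (hs : 0 < s) (q : ℝ≥0) (t : ℝ → ℝ) :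
    mapHom (RMax.rpowHom s hs) (qpow q t) = qpow q fun e => t e * s :=
  congrArg (fun f : ℝ → RMax => (f : RMaxGerm)) (funext fun _ => RMax.rpowHom_qpow s hs q _)

theorem Nonvanishing.map_rpowHom {x : RMaxGerm} (hx : Nonvanishing x) (s : ℝ) (hs : 0 < s) :
    Nonvanishing (mapHom (RMax.rpowHom s hs) x) := by
  induction x using Filter.Germ.inductionOn with | _ f =>
  exact Filter.Eventually.mono hx fun e he => RMax.rpowHom_ne_zero s hs he

end RMaxGerm

/-! ### Correspondences with values in germs -/

namespace ReducedCorrespondence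

variable {C : ReducedCorrespondence.{u}}

/-- A monomial lies below the sum of two monomials of the same value between which its left
exponent lies. -/
theorem monomial_add_of_between {p : ℝ} {b : C.carrier} {n m n₁ m₁ n₂ m₂ : ℕ}
    (h₁ : p * n₁ + m₁ = p * n + m) (h₂ : p * n₂ + m₂ = p * n + m) (hn₁ : n₁ ≤ n) (hn₂ : n ≤ n₂)
    (hb₁ : C.monomial n₁ m₁ + b = b) (hb₂ : C.monomial n₂ m₂ + b = b) :
    C.monomial n m + b = b := by
  let _ := idemCommSemiring C.one_add_one
  -- The endpoint is treated apart so that the root of order `j + i` taken below has nonzero order.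
  rcases hn₁.eq_or_lt with rfl | hlt
  · have : m₁ = m := by exact_mod_cast add_left_cancel h₁
    rwa [← this]
  obtain ⟨i, rfl⟩ := Nat.exists_eq_add_of_le hn₁
  obtain ⟨j, rfl⟩ := Nat.exists_eq_add_of_le hn₂
  -- The three exponent pairs lie on a line of slope `-p`, so `(n, m)` is the mean of the outer two
  -- with weights `j` and `i`.
  have hm : m * (j + i) = m₁ * j + m₂ * i := by
    have : (m : ℝ) * (j + i) = m₁ * j + m₂ * i := by
      push_cast at h₁ h₂
      linear_combination -(j : ℝ) * h₁ - (i : ℝ) * h₂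
    exact_mod_cast this
  have hpow : C.monomial (n₁ + i) m ^ (j + i) =
      C.monomial n₁ m₁ ^ j * C.monomial (n₁ + i + j) m₂ ^ i := by
    simp only [monomial, mul_pow, ← pow_mul]
    rw [hm, show (n₁ + i) * (j + i) = n₁ * j + (n₁ + i + j) * i by ring, pow_add, pow_add]
    ring
  have hle := le_add_of_pow_eq (C.monomial_ne_zero n₁ m₁) (by omega) hpow
  rw [add_eq_right_iff_le] at hb₁ hb₂ ⊢
  calc C.monomial (n₁ + i) m ≤ C.monomial n₁ m₁ + C.monomial (n₁ + i + j) m₂ := hle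
    _ ≤ b + b := add_le_add hb₁ hb₂
    _ = b := add_idem b

/-- The image of an element in germs is pointwise the value of one of finitely many monomials that
lie below this element. -/
theorem exists_finset_of_germ {q : ℝ≥0} (f : C.carrier →+* RMaxGerm) (v : ℕ → ℕ → ℝ → ℝ)
    (hmon : ∀ n m, f (C.monomial n m) = RMaxGerm.qpow q (v n m)) (b : C.carrier) :
    ∃ (s : Finset (ℕ × ℕ)) (g : ℝ → RMax), f b = (g : RMaxGerm) ∧
      (∀ i ∈ s, C.monomial i.1 i.2 + b = b) ∧
      ∀ e, g e = 0 ∨ ∃ i ∈ s, g e = RMax.qpow q (v i.1 i.2 e) := by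
  classical
  let _ := idemCommSemiring C.one_add_one
  induction b using C.monomial_induction with
  | zero => exact ⟨∅, 0, map_zero f, by simp, fun e => Or.inl rfl⟩
  | monomial n m =>
    exact ⟨{(n, m)}, _, hmon n m, by simp [add_idem], fun e => Or.inr ⟨(n, m), by simp, rfl⟩⟩
  | add b b' hb hb' =>
    obtain ⟨s, g, hg, hs, h⟩ := hb
    obtain ⟨s', g', hg', hs', h'⟩ := hb'
    refine ⟨s ∪ s', g + g', by rw [map_add, hg, hg']; rfl, ?_, fun e => ?_⟩
    · intro i hi
      rcases Finset.mem_union.1 hi with hi | hi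
      · rw [← add_assoc, hs i hi]
      · rw [add_left_comm, hs' i hi]
    · rw [Pi.add_apply]
      rcases RMax.add_eq_or (g e) (g' e) with h1 | h1
      · rw [h1]
        exact (h e).imp_right fun ⟨i, hi, hie⟩ => ⟨i, Finset.mem_union_left _ hi, hie⟩
      · rw [h1]
        exact (h' e).imp_right fun ⟨i, hi, hie⟩ => ⟨i, Finset.mem_union_right _ hi, hie⟩

/-- A morphism to germs sending the generators to `q^(p(1+ε))` and `q` is injective when monomials
are compared according to their values at `ε = 0`. -/
theorem injective_of_germ {q : ℝ≥0} (hq0 : 0 < q) (hq1 : q < 1) {p : ℝ} (hp : 0 < p)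
    (f : C.carrier →+* RMaxGerm)
    (hl : f C.genLeft = RMaxGerm.qpow q fun e => p * (1 + e))
    (hr : f C.genRight = RMaxGerm.qpow q fun _ => 1)
    (h : ∀ n m n' m' : ℕ, p * n + m < p * n' + m' →
      C.monomial n' m' + C.monomial n m = C.monomial n m) :
    Function.Injective f := by
  let _ := idemCommSemiring C.one_add_one
  have hmon : ∀ n m, f (C.monomial n m) =
      RMaxGerm.qpow q fun e => p * (1 + e) * n + m := fun n m => by
    simp only [monomial, map_mul, map_pow, hl, hr, RMaxGerm.qpow_pow_mul_qpow_pow hq0, one_mul]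
  refine injective_of_monomial RMaxGerm.one_add_one f fun n m b hle => ?_
  obtain ⟨s, g, hg, hs, hgs⟩ := exists_finset_of_germ f _ hmon b
  by_contra hnot
  -- A term of strictly smaller value would already dominate the monomial in `C`, by `h`.
  have hval : ∀ i ∈ s, p * n + m ≤ p * i.1 + i.2 := by
    intro i hi
    by_contra! hlt
    refine hnot ?_
    have h1 := h _ _ _ _ hlt
    have h2 := hs i hi
    rw [add_eq_right_iff_le] at h1 h2 ⊢
    exact h1.trans h2
  have hev : ∀ᶠ e : ℝ in 𝓝 0, ∃ i ∈ s, p * (1 + e) * i.1 + i.2 ≤ p * (1 + e) * n + m := by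
    rw [hmon, hg] at hle
    filter_upwards [Filter.Germ.coe_eq.1 hle] with e he
    change RMax.qpow q (p * (1 + e) * n + m) + g e = g e at he
    rcases hgs e with h0 | ⟨i, hi, hie⟩
    · rw [h0, add_zero] at he
      exact absurd he (RMax.qpow_ne_zero hq0 _)
    · rw [hie, RMax.qpow_add_qpow hq0 hq1] at he
      exact ⟨i, hi, he⟩
  -- Terms of strictly larger value at `ε = 0` keep a larger exponent nearby, uniformly because `s`
  -- is finite. The index supplied by `hev` is therefore a tie, for which the inequality reduces to
  -- one between multiples of `ε`.
  have hstrict : ∀ᶠ e : ℝ in 𝓝 0, ∀ i ∈ s, p * n + m < p * i.1 + i.2 →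
      p * (1 + e) * n + m < p * (1 + e) * i.1 + i.2 := by
    rw [Filter.eventually_all_finset]
    intro i _
    by_cases hlt : p * n + m < p * i.1 + i.2
    · have : ∀ᶠ e : ℝ in 𝓝 0, p * (1 + e) * n + m < p * (1 + e) * i.1 + i.2 :=
        ContinuousAt.eventually_lt (f := fun e : ℝ => p * (1 + e) * n + m)
          (g := fun e : ℝ => p * (1 + e) * i.1 + i.2) (by fun_prop) (by fun_prop)
          (by simpa using hlt)
      exact this.mono fun _ he _ => he
    · exact Filter.Eventually.of_forall fun _ h' => absurd h' hlt
  have heq : ∀ᶠ e : ℝ in 𝓝 0, ∃ i ∈ s, p * i.1 + i.2 = p * n + m ∧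
      e * i.1 ≤ e * n := by
    filter_upwards [hev, hstrict] with e ⟨i, hi, h1⟩ h2
    have h3 : p * i.1 + i.2 = p * n + m :=
      ((hval i hi).lt_or_eq.resolve_left fun hlt => absurd (h2 i hi hlt) (not_lt.2 h1)).symm
    refine ⟨i, hi, h3, le_of_mul_le_mul_left ?_ hp⟩
    linarith
  -- A positive and a negative `ε` yield tied terms with left exponents on either side of `n`; this
  -- uses that the neighborhoods of `0` are two-sided.
  obtain ⟨e, ⟨i, hi, hi1, hi2⟩, he⟩ :=
    ((heq.filter_mono nhdsWithin_le_nhds).and (self_mem_nhdsWithin (s := Set.Ioi (0 : ℝ)))).exists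
  obtain ⟨e', ⟨j, hj, hj1, hj2⟩, he'⟩ :=
    ((heq.filter_mono nhdsWithin_le_nhds).and (self_mem_nhdsWithin (s := Set.Iio (0 : ℝ)))).exists
  have hin : i.1 ≤ n := by exact_mod_cast le_of_mul_le_mul_left hi2 he
  have hjn : n ≤ j.1 := by exact_mod_cast (mul_le_mul_left_of_neg he').1 hj2
  exact hnot (monomial_add_of_between hi1 hj1 hin hjn (hs i hi) (hs j hj))

end ReducedCorrespondence

/-! ### The tangential deformation and the case of irrational `λ` -/

section Deformation

variable (q : ℝ≥0) (hq0 : 0 < q) (hq1 : q < 1)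

/-- The inclusion of `𝓡_ε` in the semiring of germs. -/
noncomputable def idDeformIncl : (idDeform q hq0 hq1).carrier →+* RMaxGerm :=
  contGerm.subtype.comp (Subsemiring.subtype (deformedSemiring q hq0))

theorem idDeformIncl_injective : Function.Injective (idDeformIncl q hq0 hq1) :=
  Subtype.val_injective.comp Subtype.val_injective

theorem idDeformIncl_nonvanishing (a : (idDeform q hq0 hq1).carrier) (ha : a ≠ 0) :
    RMaxGerm.Nonvanishing (idDeformIncl q hq0 hq1 a) := by
  obtain ⟨f, hf, h⟩ := (deformedSemiring_nonvanishing q hq0 a.1 a.2).resolve_left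
    fun h => ha (Subtype.ext h)
  have h' : idDeformIncl q hq0 hq1 a = (f : RMaxGerm) := h
  rw [h']
  exact hf

theorem idDeformIncl_genLeft : idDeformIncl q hq0 hq1 (idDeform q hq0 hq1).genLeft =
    RMaxGerm.qpow q fun e => 1 + e :=
  congrArg Subtype.val
    (powHom_trop_one contGerm_one_add_one (qDeform q hq0) (qDeform_add_one q hq0 hq1))

theorem idDeformIncl_genRight : idDeformIncl q hq0 hq1 (idDeform q hq0 hq1).genRight =
    RMaxGerm.qpow q fun _ => 1 :=
  congrArg Subtype.val
    (powHom_trop_one contGerm_one_add_one (qConst q hq0) (qConst_add_one q hq0 hq1))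

/-- A strict inequality at `ε = 0` persists nearby, whereas a tie between distinct monomials changes
direction with the sign of `ε`. The factor `1` matches the slope `s = 1` in
`comp_monomial_add_of_lt`. -/
theorem idDeform_monomial_add (n m n' m' : ℕ) (h : (1 : ℝ) * n + m < 1 * n' + m') :
    (idDeform q hq0 hq1).monomial n' m' + (idDeform q hq0 hq1).monomial n m =
      (idDeform q hq0 hq1).monomial n m := by
  apply idDeformIncl_injective
  simp only [ReducedCorrespondence.monomial, map_add, map_mul, map_pow, idDeformIncl_genLeft,
    idDeformIncl_genRight, RMaxGerm.qpow_pow_mul_qpow_pow hq0]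
  refine RMaxGerm.qpow_add_qpow hq0 hq1 ?_
  have : ∀ᶠ e : ℝ in 𝓝 0, (1 + e) * n + 1 * m < (1 + e) * n' + 1 * m' :=
    ContinuousAt.eventually_lt (f := fun e : ℝ => (1 + e) * n + 1 * m)
      (g := fun e : ℝ => (1 + e) * n' + 1 * m') (by fun_prop) (by fun_prop) (by simpa using h)
  exact this.mono fun _ => le_of_lt

/-- For `λ` irrational, `𝓡(λ)` deforms to germs by `q^(λ n + k) ↦ q^(t (λ (1 + ε) n + k))`. -/
theorem exists_frobenius_germ_hom {lam : ℝ} (hlam : 0 < lam) (hirr : Irrational lam) {t : ℝ}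
    (ht : 0 < t) :
    ∃ f : (frobenius q hq0 hq1 lam hlam).carrier →+* RMaxGerm,
      f (ReducedCorrespondence.genLeft _) = (RMaxGerm.qpow q fun e => lam * t * (1 + e)) ∧
      f (ReducedCorrespondence.genRight _) = (RMaxGerm.qpow q fun _ => t) ∧
      ∀ a, a ≠ 0 → RMaxGerm.Nonvanishing (f a) := by
  set C := frobenius q hq0 hq1 lam hlam
  let v : ℕ → ℕ → ℝ → ℝ := fun n k e => lam * t * (1 + e) * n + t * k
  have hv : ∀ n k, RMaxGerm.qpow q (v n k) =
      (RMaxGerm.qpow q fun e => lam * t * (1 + e)) ^ n * (RMaxGerm.qpow q fun _ => t) ^ k :=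
    fun n k => (RMaxGerm.qpow_pow_mul_qpow_pow hq0 _ _ n k).symm
  -- Irrationality of `λ` makes the exponents recoverable from the monomial, without which the
  -- deformation would not be well defined.
  have hinj : ∀ {n k n' k'}, C.monomial n k = C.monomial n' k' → n = n' ∧ k = k' := by
    intro n k n' k' h
    have := congrArg (frobIncl q hq0 hq1 lam hlam) h
    simp only [C, frobIncl_monomial] at this
    exact eq_of_irrational_mul_add hirr (RMax.qpow_injective hq0 hq1 this)
  have hadd_lt : ∀ {n k n' k' : ℕ}, lam * n + k < lam * n' + k' →
      C.monomial n' k' + C.monomial n k = C.monomial n k ∧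
      RMaxGerm.qpow q (v n' k') + RMaxGerm.qpow q (v n k) = RMaxGerm.qpow q (v n k) := by
    intro n k n' k' h
    refine ⟨frobenius_monomial_add q hq0 hq1 lam hlam n k n' k' h.le,
      RMaxGerm.qpow_add_qpow hq0 hq1 ?_⟩
    have : ∀ᶠ e : ℝ in 𝓝 0, v n k e < v n' k' e :=
      ContinuousAt.eventually_lt (by fun_prop) (by fun_prop) (by
        simp only [v]
        have := mul_lt_mul_of_pos_left h ht
        linarith)
    exact this.mono fun _ => le_of_lt
  -- The morphism is built from its graph. Since the monomials of `𝓡(λ)` are totally ordered, every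
  -- element is zero or a single monomial, so `ρ` is defined everywhere.
  let ρ : C.carrier → RMaxGerm → Prop := fun a g =>
    (a = 0 ∧ g = 0) ∨ ∃ n k, a = C.monomial n k ∧ g = RMaxGerm.qpow q (v n k)
  have hρ0 : ρ 0 0 := Or.inl ⟨rfl, rfl⟩
  have hρmon : ∀ n k, ρ (C.monomial n k) (RMaxGerm.qpow q (v n k)) :=
    fun n k => Or.inr ⟨n, k, rfl, rfl⟩
  have hρuniq : ∀ {a g g'}, ρ a g → ρ a g' → g = g' := by
    rintro a g g' (⟨ha, rfl⟩ | ⟨n, k, ha, rfl⟩) (⟨ha', rfl⟩ | ⟨n', k', ha', rfl⟩)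
    · rfl
    · exact absurd (ha'.symm.trans ha) (C.monomial_ne_zero _ _)
    · exact absurd (ha.symm.trans ha') (C.monomial_ne_zero _ _)
    · obtain ⟨rfl, rfl⟩ := hinj (ha.symm.trans ha')
      rfl
  have hρadd : ∀ {a g a' g'}, ρ a g → ρ a' g' → ρ (a + a') (g + g') := by
    rintro a g a' g' (⟨rfl, rfl⟩ | ⟨n, k, rfl, rfl⟩) hb
    · simpa using hb
    rcases hb with ⟨rfl, rfl⟩ | ⟨n', k', rfl, rfl⟩
    · simpa using hρmon n k
    -- The term of smaller value absorbs the other, in `𝓡(λ)` and among germs alike.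
    rcases lt_trichotomy (lam * n + k) (lam * n' + k') with h | h | h
    · rw [add_comm, (hadd_lt h).1, add_comm, (hadd_lt h).2]
      exact hρmon _ _
    · obtain ⟨rfl, rfl⟩ := eq_of_irrational_mul_add hirr h
      rw [show C.monomial n k + C.monomial n k = C.monomial n k from
          frobenius_monomial_add q hq0 hq1 lam hlam n k n k le_rfl,
        RMaxGerm.qpow_add_qpow hq0 hq1 (Filter.Eventually.of_forall fun _ => le_rfl)]
      exact hρmon _ _
    · rw [(hadd_lt h).1, (hadd_lt h).2]
      exact hρmon _ _
  have hρmul : ∀ {a g a' g'}, ρ a g → ρ a' g' → ρ (a * a') (g * g') := by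
    rintro a g a' g' (⟨rfl, rfl⟩ | ⟨n, k, rfl, rfl⟩) hb
    · exact Or.inl ⟨zero_mul _, zero_mul _⟩
    rcases hb with ⟨rfl, rfl⟩ | ⟨n', k', rfl, rfl⟩
    · exact Or.inl ⟨mul_zero _, mul_zero _⟩
    refine Or.inr ⟨n + n', k + k', ?_, ?_⟩
    · simp only [ReducedCorrespondence.monomial, pow_add]; ring
    · simp only [hv, pow_add]; ring
  have hρex : ∀ a, ∃ g, ρ a g := fun a => by
    induction a using C.monomial_induction with
    | zero => exact ⟨_, hρ0⟩
    | monomial n m => exact ⟨_, hρmon n m⟩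
    | add a b ha hb =>
      obtain ⟨g, hg⟩ := ha
      obtain ⟨g', hg'⟩ := hb
      exact ⟨_, hρadd hg hg'⟩
  choose f hf using hρex
  have hmon : ∀ n k, f (C.monomial n k) = RMaxGerm.qpow q (v n k) :=
    fun n k => hρuniq (hf _) (hρmon n k)
  let F : C.carrier →+* RMaxGerm :=
    { toFun := f
      map_zero' := hρuniq (hf _) hρ0
      map_one' := by
        have := hmon 0 0
        rwa [hv, pow_zero, pow_zero, mul_one, ReducedCorrespondence.monomial, pow_zero, pow_zero,
          mul_one] at this
      map_add' := fun a b => hρuniq (hf _) (hρadd (hf a) (hf b))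
      map_mul' := fun a b => hρuniq (hf _) (hρmul (hf a) (hf b)) }
  refine ⟨F, ?_, ?_, fun a ha => ?_⟩
  · have := hmon 1 0
    rwa [hv, pow_zero, pow_one, mul_one, ReducedCorrespondence.monomial, pow_zero, pow_one,
      mul_one] at this
  · have := hmon 0 1
    rwa [hv, pow_zero, pow_one, one_mul, ReducedCorrespondence.monomial, pow_zero, pow_one,
      one_mul] at this
  · rcases hf a with ⟨h, -⟩ | ⟨n, k, -, h⟩
    · exact absurd h ha
    · change RMaxGerm.Nonvanishing (f a)
      rw [h]
      exact RMaxGerm.nonvanishing_qpow hq0 _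

/-- Both sides embed in germs with generators `q^(λλ'(1+ε))` and `q`. On the left, the deformation
of `𝓡(λ)` with `t = λ'` is glued to the constant germs of `𝓡(λ')`. On the right, `𝓡_ε` raised to the
power `λλ'` is glued to the constant germs of `𝓡(λλ')`. -/
theorem frobenius_comp_equal_idDeform_comp (lam lam' : ℝ) (hlam : 0 < lam) (hlam' : 0 < lam')
    (hirr : Irrational lam) :
    ((frobenius q hq0 hq1 lam hlam).comp (frobenius q hq0 hq1 lam' hlam')).Equal
      ((idDeform q hq0 hq1).comp
        (frobenius q hq0 hq1 (lam * lam') (mul_pos hlam hlam'))) := by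
  have hp := mul_pos hlam hlam'
  obtain ⟨f, hfl, hfr, hf⟩ := exists_frobenius_germ_hom q hq0 hq1 hlam hirr hlam'
  obtain ⟨F, hFl, hFr⟩ := ReducedCorrespondence.exists_comp_hom RMaxGerm.Nonvanishing
    (fun _ _ => .add) (fun _ _ => .mul) (fun _ _ _ => RMaxGerm.Nonvanishing.mul_left_cancel) f
    (RMaxGerm.constHom.comp (frobIncl q hq0 hq1 lam' hlam')) hf
    (fun a ha => RMaxGerm.constHom_nonvanishing (frobIncl_ne_zero q hq0 hq1 lam' hlam' a ha))
    (by rw [hfr, RingHom.comp_apply, frobIncl_genLeft, RMaxGerm.constHom_qpow])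
  obtain ⟨G, hGl, hGr⟩ := ReducedCorrespondence.exists_comp_hom RMaxGerm.Nonvanishing
    (fun _ _ => .add) (fun _ _ => .mul) (fun _ _ _ => RMaxGerm.Nonvanishing.mul_left_cancel)
    ((RMaxGerm.mapHom (RMax.rpowHom (lam * lam') hp)).comp (idDeformIncl q hq0 hq1))
    (RMaxGerm.constHom.comp (frobIncl q hq0 hq1 (lam * lam') hp))
    (fun a ha => (idDeformIncl_nonvanishing q hq0 hq1 a ha).map_rpowHom _ hp)
    (fun a ha => RMaxGerm.constHom_nonvanishing (frobIncl_ne_zero q hq0 hq1 _ hp a ha))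
    (by
      rw [RingHom.comp_apply, RingHom.comp_apply, frobIncl_genLeft, RMaxGerm.constHom_qpow,
        idDeformIncl_genRight, RMaxGerm.mapHom_rpowHom_qpow]
      simp only [one_mul])
  rw [hfl] at hFl
  rw [RingHom.comp_apply, frobIncl_genRight, RMaxGerm.constHom_qpow] at hFr hGr
  rw [RingHom.comp_apply, idDeformIncl_genLeft, RMaxGerm.mapHom_rpowHom_qpow] at hGl
  simp only [mul_comm _ (lam * lam')] at hGl
  refine ReducedCorrespondence.equal_of_injective F G
    (ReducedCorrespondence.injective_of_germ hq0 hq1 hp F hFl hFr fun n m n' m' h => ?_)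
    (ReducedCorrespondence.injective_of_germ hq0 hq1 hp G hGl hGr fun n m n' m' h => ?_)
    (by rw [hFl, hGl]) (by rw [hFr, hGr])
  · exact ReducedCorrespondence.comp_monomial_add_of_lt hlam'
      (fun n m n' m' h => frobenius_monomial_add q hq0 hq1 lam hlam n m n' m' h.le)
      (fun n m n' m' h => frobenius_monomial_add q hq0 hq1 lam' hlam' n m n' m' h.le) h
  · exact ReducedCorrespondence.comp_monomial_add_of_lt (s := 1) hp
      (idDeform_monomial_add q hq0 hq1)
      (fun n m n' m' h => frobenius_monomial_add q hq0 hq1 _ hp n m n' m' h.le)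
      (by rwa [one_mul])

end Deformation

end ArithmeticSite

theorem theorem6p5 (q : ℝ≥0) (hq0 : 0 < q) (hq1 : q < 1)
    (lam lam' : ℝ) (hlam : 0 < lam) (hlam' : 0 < lam') :
    (Irrational (lam * lam') →
      ((ArithmeticSite.frobenius q hq0 hq1 lam hlam).comp
        (ArithmeticSite.frobenius q hq0 hq1 lam' hlam')).Equal
          (ArithmeticSite.frobenius q hq0 hq1 (lam * lam') (mul_pos hlam hlam'))) ∧
    (lam ∈ Set.range ((↑) : ℚ → ℝ) → lam' ∈ Set.range ((↑) : ℚ → ℝ) →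
      ((ArithmeticSite.frobenius q hq0 hq1 lam hlam).comp
        (ArithmeticSite.frobenius q hq0 hq1 lam' hlam')).Equal
          (ArithmeticSite.frobenius q hq0 hq1 (lam * lam') (mul_pos hlam hlam'))) ∧
    (Irrational lam → Irrational lam' → lam * lam' ∈ Set.range ((↑) : ℚ → ℝ) →
      ((ArithmeticSite.frobenius q hq0 hq1 lam hlam).comp
        (ArithmeticSite.frobenius q hq0 hq1 lam' hlam')).Equal
          ((ArithmeticSite.idDeform q hq0 hq1).comp
            (ArithmeticSite.frobenius q hq0 hq1 (lam * lam') (mul_pos hlam hlam')))) :=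
  ⟨ArithmeticSite.frobenius_comp_equal_of_irrational q hq0 hq1 lam lam' hlam hlam',
    fun h _ => ArithmeticSite.frobenius_comp_equal_of_rational q hq0 hq1 lam lam' hlam hlam' h,
    fun h _ _ => ArithmeticSite.frobenius_comp_equal_idDeform_comp q hq0 hq1 lam lam' hlam hlam' h⟩
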